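/- Let $d_1,d_2\ge 1$ and let $W\subset\mathbb{R}^{d_2}$ be a relatively compact Borel set whose interior is dense in $W$. Suppose that $W$ is Fourier smooth with exponent $\vartheta>0$, i.e. there is a constant $C_W$ with $$|\widehat{\chi}_W(\xi)|\le C_W\,(1+\|\xi\|)^{-(d_2+\vartheta)/2}\qquad\text{for all }\xi\in\mathbb{R}^{d_2},$$ where $\widehat f(\xi)=\int f(x)e^{-2\pi i\langle x,\xi\rangle}\,dx$. Let $\delta>0$. Then for almost every lattice $\Gamma<\mathbb{R}^{d_1}\times\mathbb{R}^{d_2}$ (with respect to the unique $\mathrm{GL}_{d_1+d_2}(\mathbb{R})$-invariant measure class on the space of lattices; equivalently, $\Gamma=g\mathbb{Z}^{d_1+d_2}$ for Haar-almost every $g\in \mathrm{GL}_{d_1+d_2}(\mathbb{R})$) the following hold. 1. $\Gamma$ projects injectively to $\mathbb{R}^{d_1}$ and densely to $\mathbb{R}^{d_2}$. Let $p$ be the cut-and-project process with parameters $(\mathbb{R}^{d_1},\mathbb{R}^{d_2},\Gamma,W)$, i.e. the random measure $p_\omega=\sum_{x\in\Lambda_\omega}\delta_x$ on $\mathbb{R}^{d_1}$,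 where $$\Lambda_\omega=\{x\in\mathbb{R}^{d_1} : (x,y)\in\omega\text{ for some }y\in W\}$$ and $\omega$ is a coset of $\Gamma$, chosen according to the invariant probability measure on the torus $(\mathbb{R}^{d_1}\times\mathbb{R}^{d_2})/\Gamma$. 2. The centered diffraction $\widehat\eta_p$ of $p$ exists and is unique. It is the positive Radon measure on $\mathbb{R}^{d_1}$ which is the Fourier transform of the centered autocorrelation $\eta_p=\eta_p^+-i_p^2\,\mathrm{Vol}_{d_1}$, i.e. $\int|\widehat f|^2\,d\widehat\eta_p=\eta_p(f*f^*)$ for all $f\in C_c(\mathbb{R}^{d_1})$, where $f^*(x)=\overline{f(-x)}$, $i_p=\mathbb{E}[p_\omega([0,1)^{d_1})]$ is the intensity of $p$ and $\eta_p^+(A)=\mathbb{E}\big[\#\{(x,y)\in\Lambda_\omega\times\Lambda_\omega : y\in[0,1)^{d_1},\ x-y\in A\}\big]$ is its autocorrelation measure. 3. $p$ is (spectrally) hyperuniform: $\lim_{\varepsilon\to0}\widehat\eta_p(B_\varepsilon)/\varepsilon^{d_1}=0$, where $B_\varepsilon\subset\mathbb{R}^{d_1}$ is the (closed) Euclidean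 ball of radius $\varepsilon$ around $0$. 4. More precisely, there is a constant $C>0$ (which may depend on $\delta,\Gamma,W,\vartheta,d_1,d_2$, but not on $\varepsilon$) such that for all $0<\varepsilon\le 1$ $$\frac{\widehat\eta_p(B_\varepsilon)}{\mathrm{Vol}_{d_1}(B_\varepsilon)}\le C\,\varepsilon^{\frac{d_1(\vartheta-\delta)}{d_2+\delta}}.$$ -/

import Mathlib

namespace Hyperuniform

open MeasureTheory Module Set Filter Topology
open scoped FourierTransform

/-- Euclidean space of dimension `d`. -/
abbrev E (d : ℕ) : Type := EuclideanSpace ℝ (Fin d)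

/-! ### Autocorrelation and diffraction of random measures on Euclidean space

A random measure on `E d` is a map `p : Ω → Measure (E d)` on a probability space `(Ω, P)`. -/

section RandomMeasures

variable {d : ℕ} {Ω : Type*} [MeasurableSpace Ω]

/-- The half-open unit cube, a Borel set of Lebesgue measure one. -/
def unitCube (d : ℕ) : Set (E d) := {x | ∀ i, x i ∈ Ico (0 : ℝ) 1}

/-- The intensity `𝔼[p([0,1)^d)]`. -/
noncomputable def intensity (P : Measure Ω) (p : Ω → Measure (E d)) : ℝ :=
  (∫⁻ ω, p ω (unitCube d) ∂P).toReal

/-- The second moment measure `B ↦ 𝔼[(p ⊗ p)(B)]`. -/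
noncomputable def secondMoment (P : Measure Ω) (p : Ω → Measure (E d)) : Measure (E d × E d) :=
  P.bind fun ω => (p ω).prod (p ω)

/-- The autocorrelation measure
`η⁺(A) = ∫∫ 1_A(x - y) ρ(y) dM²(x, y)`, with `ρ` the indicator function of the unit cube. For an
invariant random measure it does not depend on the choice of `ρ ≥ 0` with integral one. -/
noncomputable def autocorrelation (P : Measure Ω) (p : Ω → Measure (E d)) : Measure (E d) :=
  ((secondMoment P p).restrict (univ ×ˢ unitCube d)).map fun z => z.1 - z.2

/-- The centered autocorrelation `η = η⁺ - i² · Vol`, a signed Radon measure, as a functional on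
continuous functions with compact support. -/
noncomputable def centeredAutocorrelation (P : Measure Ω) (p : Ω → Measure (E d))
    (f : E d → ℂ) : ℂ :=
  (∫ x, f x ∂(autocorrelation P p)) - (intensity P p : ℂ) ^ 2 * ∫ x, f x

/-- The function `f ∗ f*`, where `f*(x)` is the complex conjugate of `f(-x)`. -/
noncomputable def convStar (f : E d → ℂ) (x : E d) : ℂ :=
  ∫ y, f y * starRingEnd ℂ (f (y - x))

/-- `σ` is the Fourier transform of the positive-definite signed measure `η`: the positive Radon
measure such that `σ(|f̂|²) = η(f ∗ f*)` for all continuous `f` with compact support. Here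
`f̂(ξ) = ∫ f(x) exp(-2πi⟨x, ξ⟩) dx`. -/
def IsFourierTransformOf (η : (E d → ℂ) → ℂ) (σ : Measure (E d)) : Prop :=
  IsLocallyFiniteMeasure σ ∧
    ∀ f : E d → ℂ, Continuous f → HasCompactSupport f →
      Integrable (fun ξ => ‖𝓕 f ξ‖ ^ 2) σ ∧
        ((∫ ξ, ‖𝓕 f ξ‖ ^ 2 ∂σ : ℝ) : ℂ) = η (convStar f)

/-- `σ` is the centered diffraction of the random measure `p`. -/
def IsCenteredDiffraction (P : Measure Ω) (p : Ω → Measure (E d)) (σ : Measure (E d)) : Prop :=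
  IsFourierTransformOf (centeredAutocorrelation P p) σ

/-- (Spectral) hyperuniformity of a random measure, expressed by its centered diffraction `σ`:
`σ(B_t) / t^d → 0` as `t → 0`. -/
def IsSpectrallyHyperuniform (σ : Measure (E d)) : Prop :=
  Tendsto (fun t : ℝ => σ.real (Metric.closedBall 0 t) / t ^ d) (𝓝[>] 0) (𝓝 0)

end RandomMeasures

/-! ### Windows -/

section Windows

variable {d : ℕ}

/-- A relatively compact Borel set with dense interior. -/
def IsWindow (W : Set (E d)) : Prop :=
  MeasurableSet W ∧ Bornology.IsBounded W ∧ W ⊆ closure (interior W)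

/-- `W` is Fourier smooth with exponent `ϑ`. -/
def FourierSmooth (W : Set (E d)) (ϑ : ℝ) : Prop :=
  ∃ C : ℝ, ∀ ξ : E d,
    ‖𝓕 (W.indicator (fun _ => (1 : ℂ))) ξ‖ ≤ C * (1 + ‖ξ‖) ^ (-((d + ϑ) / 2))

end Windows

/-! ### Cut-and-project processes -/

section CutAndProject

variable {d₁ d₂ : ℕ}

/-- `Γ` projects injectively to the first factor. -/
def ProjectsInjectively (Γ : Submodule ℤ (E d₁ × E d₂)) : Prop :=
  InjOn Prod.fst (Γ : Set (E d₁ × E d₂))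

/-- `Γ` projects densely to the second factor. -/
def ProjectsDensely (Γ : Submodule ℤ (E d₁ × E d₂)) : Prop :=
  Dense (Prod.snd '' (Γ : Set (E d₁ × E d₂)))

/-- The torus `Ω = (E d₁ × E d₂) / Γ`. -/
abbrev Torus (Γ : Submodule ℤ (E d₁ × E d₂)) : Type :=
  (E d₁ × E d₂) ⧸ Γ.toAddSubgroup

/-- A Borel fundamental domain of the lattice `Γ`: the half-open parallelepiped spanned by some
`ℤ`-basis of `Γ`. -/
noncomputable def fundDomain (Γ : Submodule ℤ (E d₁ × E d₂)) [DiscreteTopology Γ]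
    [IsZLattice ℝ Γ] : Set (E d₁ × E d₂) :=
  ZSpan.fundamentalDomain ((Module.Free.chooseBasis ℤ Γ).ofZLatticeBasis ℝ Γ)

/-- The translation-invariant probability measure on the torus: normalized Lebesgue measure on a
fundamental domain, transported to the quotient. -/
noncomputable def torusMeasure (Γ : Submodule ℤ (E d₁ × E d₂)) [DiscreteTopology Γ]
    [IsZLattice ℝ Γ] : Measure (Torus Γ) :=
  (volume (fundDomain Γ))⁻¹ •
    (volume.restrict (fundDomain Γ)).map (QuotientAddGroup.mk' Γ.toAddSubgroup)

/-- The random point set of the cut-and-project process with lattice `Γ` and window `W`. For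
`ω = (g, h) + Γ` it is `pr₁ (Γ ∩ (E d₁ × (W - h))) + g`, that is, the set of first coordinates of
the points of the coset `ω` whose second coordinate lies in `W`. -/
def cutAndProjectSet (Γ : Submodule ℤ (E d₁ × E d₂)) (W : Set (E d₂)) (ω : Torus Γ) :
    Set (E d₁) :=
  {x | ∃ y ∈ W, QuotientAddGroup.mk' Γ.toAddSubgroup (x, y) = ω}

/-- The cut-and-project process, as a random measure: `ω ↦ ∑ δ_x`, where `x` runs through the
random point set. -/
noncomputable def cutAndProject (Γ : Submodule ℤ (E d₁ × E d₂)) (W : Set (E d₂)) (ω : Torus Γ) :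
    Measure (E d₁) :=
  Measure.sum fun x : cutAndProjectSet Γ W ω => Measure.dirac (x : E d₁)

end CutAndProject

/-! ### Generic lattices -/

section GenericLattices

/-- The group `GL_{d₁+d₂}(ℝ)`, with rows and columns indexed by the coordinates of the two
factors. -/
abbrev GLGroup (d₁ d₂ : ℕ) : Type := Matrix.GeneralLinearGroup (Fin d₁ ⊕ Fin d₂) ℝ

noncomputable instance instMeasurableSpaceGL (d₁ d₂ : ℕ) : MeasurableSpace (GLGroup d₁ d₂) := borel _

instance instBorelSpaceGL (d₁ d₂ : ℕ) : BorelSpace (GLGroup d₁ d₂) := ⟨rfl⟩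

instance instLocallyCompactSpaceGL (d₁ d₂ : ℕ) : LocallyCompactSpace (GLGroup d₁ d₂) := by
  let _ : NormedRing (Matrix (Fin d₁ ⊕ Fin d₂) (Fin d₁ ⊕ Fin d₂) ℝ) := Matrix.linftyOpNormedRing
  let _ : NormedAlgebra ℝ (Matrix (Fin d₁ ⊕ Fin d₂) (Fin d₁ ⊕ Fin d₂) ℝ) :=
    Matrix.linftyOpNormedAlgebra
  have : CompleteSpace (Matrix (Fin d₁ ⊕ Fin d₂) (Fin d₁ ⊕ Fin d₂) ℝ) :=
    FiniteDimensional.complete ℝ _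
  have : ProperSpace (Matrix (Fin d₁ ⊕ Fin d₂) (Fin d₁ ⊕ Fin d₂) ℝ) :=
    FiniteDimensional.proper ℝ _
  exact (Units.isOpenEmbedding_val
    (R := Matrix (Fin d₁ ⊕ Fin d₂) (Fin d₁ ⊕ Fin d₂) ℝ)).locallyCompactSpace

/-- The standard basis of `E d₁ × E d₂`. -/
noncomputable def stdBasis (d₁ d₂ : ℕ) : Basis (Fin d₁ ⊕ Fin d₂) ℝ (E d₁ × E d₂) :=
  (EuclideanSpace.basisFun (Fin d₁) ℝ).toBasis.prod (EuclideanSpace.basisFun (Fin d₂) ℝ).toBasis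

/-- The basis of `E d₁ × E d₂` given by the columns of the invertible matrix `g`. -/
noncomputable def columnBasis {d₁ d₂ : ℕ} (g : GLGroup d₁ d₂) :
    Basis (Fin d₁ ⊕ Fin d₂) ℝ (E d₁ × E d₂) :=
  (stdBasis d₁ d₂).map (Matrix.toLinearEquiv (stdBasis d₁ d₂) (g : Matrix _ _ ℝ)
    ((Matrix.isUnit_iff_isUnit_det _).1 g.isUnit))

/-- The lattice `g ℤ^{d₁+d₂}`. -/
abbrev latticeOf {d₁ d₂ : ℕ} (g : GLGroup d₁ d₂) : Submodule ℤ (E d₁ × E d₂) :=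
  Submodule.span ℤ (range (columnBasis g))

/-- `Q` holds for almost every lattice in `E d₁ × E d₂`, with respect to the unique
`GL_{d₁+d₂}(ℝ)`-invariant measure class on the space `GL_{d₁+d₂}(ℝ) / GL_{d₁+d₂}(ℤ)` of lattices:
a set of lattices is null if and only if its preimage under `g ↦ g ℤ^{d₁+d₂}` is a null set for
Haar measure. -/
def ForAlmostEveryLattice (d₁ d₂ : ℕ)
    (Q : ∀ (Γ : Submodule ℤ (E d₁ × E d₂)) [DiscreteTopology Γ] [IsZLattice ℝ Γ], Prop) : Prop :=
  ∀ᵐ g ∂(Measure.haar : Measure (GLGroup d₁ d₂)), Q (latticeOf g)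

end GenericLattices

end Hyperuniform

set_option linter.unusedSectionVars false

/-! The diffraction is pure point. Parseval's identity for the `Γ`-periodization of `f ⊗ χ_W` is a
Poisson summation formula (`hasSum_dualSet`). It shows that the diffraction puts mass `covol⁻²
|χ̂_W(y₂)|²` at `y₁` for every vector `y = (y₁, y₂)` of the dual lattice. Subtracting `i² Vol`
removes exactly the atom of `y = 0`, because `i = vol W / covol`
(`isCenteredDiffraction_diffraction`). Uniqueness is polarization: the integrals of `|f̂|²` for all
`f` recover the characteristic functions of the finite measures `|f̂|² σ`.

A small ball thus sees only nonzero dual vectors with `‖y₁‖ ≤ ε`. By Borel-Cantelli (the convergence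
part of Khinchin-Groshev), for almost every lattice all nonzero dual vectors satisfy `‖y₁‖ ≥ c (1 +
‖y₁‖ + ‖y₂‖)^(-κ)` as soon as `κ > d₂ / d₁` (`ae_dualSet_diophantine`). Applied to these vectors and
to their differences, this makes the second components large and mutually separated, both at scale
`r ~ ε^(-1/κ)`. After division by `r`, the sum of `(1 + ‖y₂‖)^(-(d₂+ϑ))` is at most `r^(-(d₂+ϑ))`
times a constant that serves all half-separated families (`exists_tsum_separated_le`). Hence the
ball has mass `O(ε^((d₂+ϑ)/κ))` (`diffraction_closedBall_le`). For `κ = (d₂+δ)/d₁` this exponent is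
`d₁ + d₁(ϑ-δ)/(d₂+δ)`.

The same Diophantine bound gives `y₁ ≠ 0` for nonzero dual vectors, which is dual to density of the
second projection (`projectsDensely_of_dualSet`). -/

namespace Hyperuniform

open MeasureTheory Module Set Filter Topology
open scoped FourierTransform ENNReal

/-! ### Sums over separated families -/

section Separated

variable {V : Type*} [NormedAddCommGroup V] [NormedSpace ℝ V] [FiniteDimensional ℝ V]

/-- Over half-separated families the sum of `(1 + ‖u i‖) ^ (-s)` is bounded uniformly. -/
theorem exists_tsum_separated_le {s : ℝ} (hs : (finrank ℝ V : ℝ) < s) :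
    ∃ K : ℝ≥0∞, K ≠ ⊤ ∧ ∀ {ι : Type} (u : ι → V), (∀ i j, i ≠ j → 1 / 2 ≤ ‖u i - u j‖) →
      ∑' i, ENNReal.ofReal ((1 + ‖u i‖) ^ (-s)) ≤ K := by
  have hs0 : 0 < s := lt_of_le_of_lt (Nat.cast_nonneg _) hs
  borelize V
  let μ : Measure V := Measure.addHaar
  let v := μ (Metric.ball 0 (1 / 4))
  have hv0 : v ≠ 0 := (Metric.measure_ball_pos μ 0 (by norm_num)).ne'
  have hvt : v ≠ ⊤ := measure_ball_lt_top.ne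
  let I := ∫⁻ x : V, ENNReal.ofReal ((1 + ‖x‖) ^ (-s)) ∂μ
  have hI : I ≠ ⊤ := (finite_integral_one_add_norm hs).ne
  -- On the ball of radius `1/4` around `u i` one has `1 + ‖x‖ ≤ (5/4)(1 + ‖u i‖)`, so each term is
  -- at most `q / v` times the integral over its ball. These balls are disjoint, and the total
  -- integral does not depend on the family.
  let q := ENNReal.ofReal ((5 / 4 : ℝ) ^ s)
  refine ⟨q * v⁻¹ * I, ENNReal.mul_ne_top (ENNReal.mul_ne_top ENNReal.ofReal_ne_top
    (ENNReal.inv_ne_top.2 hv0)) hI, fun {ι} u hu => ?_⟩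
  have key : ∀ i, ENNReal.ofReal ((1 + ‖u i‖) ^ (-s)) ≤
      q * v⁻¹ * ∫⁻ x in Metric.ball (u i) (1 / 4), ENNReal.ofReal ((1 + ‖x‖) ^ (-s)) ∂μ := by
    intro i
    have h1 : ENNReal.ofReal ((5 / 4 : ℝ) ^ (-s) * (1 + ‖u i‖) ^ (-s)) * v ≤
        ∫⁻ x in Metric.ball (u i) (1 / 4), ENNReal.ofReal ((1 + ‖x‖) ^ (-s)) ∂μ := by
      have hvi : v = μ (Metric.ball (u i) (1 / 4)) := (Measure.addHaar_ball_center μ (u i) _).symm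
      rw [hvi, ← setLIntegral_const]
      refine setLIntegral_mono' measurableSet_ball fun x hx => ENNReal.ofReal_le_ofReal ?_
      rw [← Real.mul_rpow (by norm_num) (by positivity)]
      refine Real.rpow_le_rpow_of_nonpos (by positivity) ?_ (by linarith)
      have h2 : ‖x - u i‖ < 1 / 4 := by rwa [Metric.mem_ball, dist_eq_norm] at hx
      have h3 := norm_le_norm_add_norm_sub (u i) x
      rw [norm_sub_rev] at h3
      have := norm_nonneg (u i)
      linarith
    have h4 : ENNReal.ofReal ((1 + ‖u i‖) ^ (-s)) =
        q * v⁻¹ * (ENNReal.ofReal ((5 / 4 : ℝ) ^ (-s) * (1 + ‖u i‖) ^ (-s)) * v) := by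
      rw [ENNReal.ofReal_mul (by positivity)]
      have h5 : q * ENNReal.ofReal ((5 / 4 : ℝ) ^ (-s)) = 1 := by
        rw [← ENNReal.ofReal_mul (by positivity), ← Real.rpow_add (by norm_num)]
        simp
      calc _ = (q * ENNReal.ofReal ((5 / 4 : ℝ) ^ (-s))) * (v⁻¹ * v) *
            ENNReal.ofReal ((1 + ‖u i‖) ^ (-s)) := by
              rw [h5, ENNReal.inv_mul_cancel hv0 hvt, one_mul, one_mul]
        _ = _ := by ring
    rw [h4]
    gcongr
  rw [ENNReal.tsum_eq_iSup_sum]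
  refine iSup_le fun t => (Finset.sum_le_sum fun i _ => key i).trans ?_
  rw [← Finset.mul_sum]
  gcongr
  rw [← lintegral_biUnion_finset]
  · exact setLIntegral_le_lintegral _ _
  · intro i _ j _ hij
    refine Metric.ball_disjoint_ball ?_
    rw [dist_eq_norm]
    linarith [hu i j hij]
  · exact fun _ _ => measurableSet_ball

end Separated

/-! ### Metric Diophantine approximation for linear forms -/

section Diophantine

variable {ι : Type} [Fintype ι]

theorem summable_one_add_norm_int_rpow {s : ℝ} (hs : (Fintype.card ι : ℝ) < s) :
    ∑' m : ι → ℤ, ENNReal.ofReal ((1 + ‖m‖) ^ (-s)) ≠ ⊤ := by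
  obtain ⟨K, hK, h⟩ := exists_tsum_separated_le (V := ι → ℝ) (s := s) (by simpa using hs)
  have := h (fun m : ι → ℤ => fun i => (m i : ℝ)) ?_
  · refine ne_top_of_le_ne_top hK (le_of_eq_of_le ?_ this)
    refine tsum_congr fun m => ?_
    congr 3
  · intro m m' hm
    obtain ⟨i, hi⟩ := Function.ne_iff.1 hm
    refine le_trans ?_ (norm_le_pi_norm _ i)
    have : (1 : ℝ) ≤ |((m i - m' i : ℤ) : ℝ)| := by
      exact_mod_cast Int.one_le_abs (sub_ne_zero.2 hi)
    simp only [Pi.sub_apply, Real.norm_eq_abs]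
    push_cast at this
    linarith

variable [DecidableEq ι]

/-- The part of a cube of side `2 R` that lies between two parallel hyperplanes. -/
theorem volume_slab_le (m : ι → ℤ) (hm : m ≠ 0) (R η : ℝ) (hR : 0 ≤ R) (hη : 0 ≤ η) :
    volume {x : ι → ℝ | (∀ j, |x j| ≤ R) ∧ |∑ j, m j * x j| ≤ η} ≤
      ENNReal.ofReal ((2 * R) ^ (Fintype.card ι - 1) * (2 * η) / ‖m‖) := by
  have hne : Nonempty ι := by
    obtain ⟨i, _⟩ := Function.ne_iff.1 hm
    exact ⟨i⟩
  obtain ⟨j, hj⟩ := Finite.exists_max fun i => ‖m i‖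
  have hmj : ‖m‖ = |(m j : ℝ)| := by
    refine le_antisymm ((pi_norm_le_iff_of_nonneg (by positivity)).2 fun i => ?_) ?_
    · simpa [Int.norm_eq_abs] using hj i
    · simpa [Int.norm_eq_abs] using norm_le_pi_norm m j
  have hm0 : (m j : ℝ) ≠ 0 := by
    intro h
    rw [h, abs_zero, norm_eq_zero] at hmj
    exact hm hmj
  -- Replacing coordinate `j` by the linear form maps the slab into a box of width `2η` in one
  -- direction and `2R` in the others. The determinant is `m j`, of absolute value `‖m‖` by the
  -- choice of `j`.
  let A : Matrix ι ι ℝ := Matrix.updateRow 1 j fun i => (m i : ℝ)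
  have hdet : LinearMap.det (Matrix.toLin' A) = m j := by
    rw [LinearMap.det_toLin', ← Matrix.cramer_transpose_apply, Matrix.transpose_one,
      Matrix.cramer_one, Module.End.one_apply]
  let r : ι → ℝ := Function.update (fun _ => R) j η
  have hsub : {x : ι → ℝ | (∀ j, |x j| ≤ R) ∧ |∑ j, m j * x j| ≤ η} ⊆
      Matrix.toLin' A ⁻¹' Set.pi univ fun i => Icc (-r i) (r i) := by
    rintro x ⟨hx1, hx2⟩ i -
    rw [Set.mem_Icc, ← abs_le, Matrix.toLin'_apply]
    by_cases hij : i = j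
    · subst hij
      simpa [A, r, Matrix.mulVec, dotProduct] using hx2
    · have : (A.mulVec x) i = x i := by
        rw [Matrix.mulVec, show A i = (1 : Matrix ι ι ℝ) i from Matrix.updateRow_ne hij]
        exact congrFun (Matrix.one_mulVec x) i
      rw [this]
      simpa [r, hij] using hx1 i
  refine (measure_mono hsub).trans ?_
  rw [Measure.addHaar_preimage_linearMap _ (by rw [hdet]; exact hm0), hdet, volume_pi_pi,
    ← Finset.mul_prod_erase _ _ (Finset.mem_univ j),
    Finset.prod_congr rfl (g := fun _ => ENNReal.ofReal (2 * R))]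
  · rw [Finset.prod_const, Finset.card_erase_of_mem (Finset.mem_univ _), Finset.card_univ,
      Real.volume_Icc, ← ENNReal.ofReal_pow (by positivity), ← ENNReal.ofReal_mul (by simp [r, hη]),
      ← ENNReal.ofReal_mul (by positivity), hmj, abs_inv]
    refine le_of_eq (congrArg _ ?_)
    simp only [r, Function.update_self]
    field_simp
    ring
  · intro i hi
    rw [Real.volume_Icc]
    simp only [r, Function.update_of_ne (Finset.ne_of_mem_erase hi)]
    congr 1
    ring

/-- The convergence part of the Khinchin-Groshev theorem, for the linear forms with coefficient
vectors `N i`, `i ∈ J`. -/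
theorem ae_exists_le_linear_forms (J : Finset ι) (κ : ℝ)
    (hJ : (Fintype.card ι : ℝ) < (κ + 1) * J.card) :
    ∀ᵐ N : ι → ι → ℝ, {m : ι → ℤ | m ≠ 0 ∧
      ∀ i ∈ J, |∑ j, m j * N i j| ≤ (1 + ‖m‖) ^ (-κ)}.Finite := by
  -- Borel-Cantelli on matrices with bounded entries. Each row in `J` lies in a slab of volume `O((1
  -- + ‖m‖)^(-(κ+1)))`, and the rows are independent, so the measures are `O((1 +
  -- ‖m‖)^(-(κ+1)|J|))`, which `hJ` makes summable.
  have hbox : ∀ R : ℕ, ∀ᵐ N : ι → ι → ℝ, {m : ι → ℤ | N ∈ {N : ι → ι → ℝ | m ≠ 0 ∧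
      (∀ i j, |N i j| ≤ R) ∧ ∀ i ∈ J, |∑ j, m j * N i j| ≤ (1 + ‖m‖) ^ (-κ)}}.Finite := by
    intro R
    let n := Fintype.card ι
    -- The factor `4` combines the slab width `2η` with `1 / ‖m‖ ≤ 2 / (1 + ‖m‖)`, valid for `‖m‖ ≥
    -- 1`.
    let A : ℝ := (2 * R) ^ (n - 1) * 4
    refine ae_finite_setOfPred_mem (ne_top_of_le_ne_top (b := ∑' m : ι → ℤ,
      (ENNReal.ofReal A ^ J.card * (ENNReal.ofReal (2 * R) ^ n) ^ (Jᶜ).card) *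
        ENNReal.ofReal ((1 + ‖m‖) ^ (-((κ + 1) * J.card)))) ?_ ?_)
    · rw [ENNReal.tsum_mul_left]
      exact ENNReal.mul_ne_top (ENNReal.mul_ne_top (ENNReal.pow_ne_top ENNReal.ofReal_ne_top)
        (ENNReal.pow_ne_top (ENNReal.pow_ne_top ENNReal.ofReal_ne_top)))
        (summable_one_add_norm_int_rpow hJ)
    · refine ENNReal.tsum_le_tsum fun m => ?_
      by_cases hm : m = 0
      · simp [hm]
      have hm1 : 1 ≤ ‖m‖ := by
        obtain ⟨i, hi⟩ := Function.ne_iff.1 hm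
        refine le_trans ?_ (norm_le_pi_norm m i)
        rw [Int.norm_eq_abs]
        exact_mod_cast Int.one_le_abs hi
      let S : Set (ι → ℝ) := {x | (∀ j, |x j| ≤ R) ∧ |∑ j, m j * x j| ≤ (1 + ‖m‖) ^ (-κ)}
      let Q : Set (ι → ℝ) := Set.pi univ fun _ => Icc (-R : ℝ) R
      have hS : volume S ≤ ENNReal.ofReal A * ENNReal.ofReal ((1 + ‖m‖) ^ (-(κ + 1))) := by
        refine (volume_slab_le m hm R _ (Nat.cast_nonneg _) (by positivity)).trans ?_
        rw [← ENNReal.ofReal_mul (by positivity)]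
        refine ENNReal.ofReal_le_ofReal ?_
        have h1 : (1 + ‖m‖) ^ (-(κ + 1)) = (1 + ‖m‖) ^ (-κ) / (1 + ‖m‖) := by
          rw [neg_add, Real.rpow_add (by positivity), Real.rpow_neg_one, div_eq_mul_inv]
        rw [h1]
        have h2 : 1 / ‖m‖ ≤ 2 / (1 + ‖m‖) := by
          rw [div_le_div_iff₀ (by positivity) (by positivity)]
          linarith
        calc _ = ((2 * R) ^ (n - 1) * 2 * (1 + ‖m‖) ^ (-κ)) * (1 / ‖m‖) := by ring
          _ ≤ ((2 * R) ^ (n - 1) * 2 * (1 + ‖m‖) ^ (-κ)) * (2 / (1 + ‖m‖)) := by gcongr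
          _ = _ := by ring
      have hQ : volume Q ≤ ENNReal.ofReal (2 * R) ^ n := by
        rw [volume_pi_pi, Finset.prod_const, Finset.card_univ, Real.volume_Icc]
        refine le_of_eq ?_
        congr 2
        ring
      have hsub : {N : ι → ι → ℝ | m ≠ 0 ∧ (∀ i j, |N i j| ≤ R) ∧
          ∀ i ∈ J, |∑ j, m j * N i j| ≤ (1 + ‖m‖) ^ (-κ)} ⊆
          Set.pi univ fun i => if i ∈ J then S else Q := by
        rintro N ⟨-, hN1, hN2⟩ i -
        by_cases hi : i ∈ J
        · simpa only [hi, if_true] using ⟨hN1 i, hN2 i hi⟩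
        · simp only [hi, if_false]
          exact fun j _ => abs_le.1 (hN1 i j)
      refine (measure_mono hsub).trans ?_
      rw [volume_pi_pi]
      have : ∀ i, volume (if i ∈ J then S else Q) ≤
          if i ∈ J then ENNReal.ofReal A * ENNReal.ofReal ((1 + ‖m‖) ^ (-(κ + 1)))
            else ENNReal.ofReal (2 * R) ^ n := by
        intro i
        split_ifs
        exacts [hS, hQ]
      refine (Finset.prod_le_prod' fun i _ => this i).trans (le_of_eq ?_)
      rw [Finset.prod_ite, Finset.prod_const, Finset.prod_const, Finset.filter_mem_eq_inter,
        Finset.univ_inter, mul_pow, ← ENNReal.ofReal_pow (by positivity) J.card,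
        ← ENNReal.ofReal_pow (by positivity) J.card, ← Real.rpow_mul_natCast (by positivity),
        neg_mul]
      have : Finset.filter (fun i => i ∉ J) Finset.univ = Jᶜ := by
        ext; simp
      rw [this]
      ring
  filter_upwards [ae_all_iff.2 hbox] with N hN
  obtain ⟨R, hR⟩ := exists_nat_ge (∑ i, ∑ j, |N i j|)
  refine (hN R).subset fun m hm => ⟨hm.1, fun i j => le_trans ?_ hR, hm.2⟩
  exact (Finset.single_le_sum (f := fun j => |N i j|) (fun _ _ => abs_nonneg _)
    (Finset.mem_univ j)).trans (Finset.single_le_sum (f := fun i => ∑ j, |N i j|)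
    (fun _ _ => Finset.sum_nonneg fun _ _ => abs_nonneg _) (Finset.mem_univ i))

/-- Almost every linear form has no integer zeros. -/
theorem ae_linear_form_ne_zero (i : ι) :
    ∀ᵐ N : ι → ι → ℝ, ∀ m : ι → ℤ, m ≠ 0 → ∑ j, m j * N i j ≠ 0 := by
  rw [ae_all_iff]
  intro m
  by_cases hm : m = 0
  · simp [hm]
  -- For fixed `m ≠ 0` the zeros form the kernel of a nonzero functional, a proper subspace and
  -- hence a null set. There are countably many `m`.
  let L : (ι → ι → ℝ) →ₗ[ℝ] ℝ := ∑ j, (m j : ℝ) •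
    (LinearMap.proj (R := ℝ) (φ := fun _ : ι => ℝ) j ∘ₗ
      LinearMap.proj (R := ℝ) (φ := fun _ : ι => ι → ℝ) i)
  have hL : ∀ N, L N = ∑ j, m j * N i j := fun N => by simp [L]
  have := Measure.addHaar_submodule volume (LinearMap.ker L) (by
    intro h
    rw [LinearMap.ker_eq_top] at h
    obtain ⟨k, hk⟩ := Function.ne_iff.1 hm
    have := hL (Pi.single i (Pi.single k 1))
    rw [h] at this
    simp [Pi.single_apply] at this
    exact hk (by exact_mod_cast this.symm))
  rw [ae_iff]
  convert this using 2
  ext N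
  simp [hm, ← hL]

end Diophantine

/-! ### From Lebesgue-null sets of matrices to Haar-null sets -/

section HaarNull

variable {d₁ d₂ : ℕ}

instance instSecondCountableTopologyGL (d₁ d₂ : ℕ) : SecondCountableTopology (GLGroup d₁ d₂) := by
  let _ : NormedRing (Matrix (Fin d₁ ⊕ Fin d₂) (Fin d₁ ⊕ Fin d₂) ℝ) := Matrix.linftyOpNormedRing
  let _ : NormedAlgebra ℝ (Matrix (Fin d₁ ⊕ Fin d₂) (Fin d₁ ⊕ Fin d₂) ℝ) :=
    Matrix.linftyOpNormedAlgebra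
  have : CompleteSpace (Matrix (Fin d₁ ⊕ Fin d₂) (Fin d₁ ⊕ Fin d₂) ℝ) :=
    FiniteDimensional.complete ℝ _
  have : SecondCountableTopology (Matrix (Fin d₁ ⊕ Fin d₂) (Fin d₁ ⊕ Fin d₂) ℝ) :=
    inferInstanceAs (SecondCountableTopology (Fin d₁ ⊕ Fin d₂ → Fin d₁ ⊕ Fin d₂ → ℝ))
  exact (Units.isOpenEmbedding_val
    (R := Matrix (Fin d₁ ⊕ Fin d₂) (Fin d₁ ⊕ Fin d₂) ℝ)).isEmbedding.secondCountableTopology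

/-- Properties of Lebesgue-almost every matrix hold Haar-almost everywhere on the general linear
group. -/
theorem ae_haar_of_ae_volume {P : (Fin d₁ ⊕ Fin d₂ → Fin d₁ ⊕ Fin d₂ → ℝ) → Prop}
    (hP : ∀ᵐ N, P N)
    (e : Matrix (Fin d₁ ⊕ Fin d₂) (Fin d₁ ⊕ Fin d₂) ℝ ≃ₗ[ℝ]
      (Fin d₁ ⊕ Fin d₂ → Fin d₁ ⊕ Fin d₂ → ℝ)) :
    ∀ᵐ g : GLGroup d₁ d₂ ∂Measure.haar,
      P (e g.1) := by
  let M := Fin d₁ ⊕ Fin d₂ → Fin d₁ ⊕ Fin d₂ → ℝ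
  let S : Set M := toMeasurable volume {N | ¬ P N}
  have hS : MeasurableSet S := measurableSet_toMeasurable _ _
  have hS0 : volume S = 0 := by rw [measure_toMeasurable]; exact hP
  have he : Continuous e := e.toLinearMap.continuous_of_finiteDimensional
  -- For fixed `g` the map `X ↦ e (X g)` is a linear automorphism, so it pulls the null set `S` back
  -- to a null set. By Fubini, almost every `X` has a Haar-null fibre in `g`. Some such `X` is
  -- invertible, since the invertible matrices are open and nonempty, and left invariance then
  -- removes `X`. No density of Haar measure is needed.
  let F : M × GLGroup d₁ d₂ → M := fun p =>
    e (Matrix.of p.1 * (p.2 : Matrix (Fin d₁ ⊕ Fin d₂) (Fin d₁ ⊕ Fin d₂) ℝ))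
  have hF : Measurable F := by
    have h1 : Continuous fun p : M × GLGroup d₁ d₂ =>
        (Matrix.of p.1 : Matrix (Fin d₁ ⊕ Fin d₂) (Fin d₁ ⊕ Fin d₂) ℝ) := continuous_fst
    exact (he.comp (h1.mul (Units.continuous_val.comp continuous_snd))).measurable
  have hT : MeasurableSet (F ⁻¹' S) := hF hS
  let μ : Measure (GLGroup d₁ d₂) := Measure.haar
  have hprod : ((volume : Measure M).prod μ) (F ⁻¹' S) = 0 := by
    rw [Measure.prod_apply_symm hT]
    refine lintegral_eq_zero_of_ae_eq_zero (Eventually.of_forall fun g => ?_)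
    let L : M ≃ₗ[ℝ] M := (((Matrix.ofLinearEquiv ℝ).trans
      (LinearEquiv.ofBijective (LinearMap.mulRight ℝ
        (g : Matrix (Fin d₁ ⊕ Fin d₂) (Fin d₁ ⊕ Fin d₂) ℝ)) (by
          refine ⟨fun a b h => ?_, fun a => ⟨a * (g⁻¹ : GLGroup d₁ d₂), ?_⟩⟩
          · simpa using congrArg (· * ((g⁻¹ : GLGroup d₁ d₂) :
              Matrix (Fin d₁ ⊕ Fin d₂) (Fin d₁ ⊕ Fin d₂) ℝ)) h
          · simp [mul_assoc]))).trans e)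
    change volume (L.toLinearMap ⁻¹' S) = 0
    rw [Measure.addHaar_preimage_linearMap _ (LinearEquiv.isUnit_det' L).ne_zero, hS0, mul_zero]
  have hae : ∀ᵐ X : M, μ (Prod.mk X ⁻¹' (F ⁻¹' S)) = 0 :=
    (Measure.measure_prod_null hT).1 hprod
  have hopen : IsOpen {X : M | (Matrix.of X).det ≠ 0} := by
    refine isOpen_ne_fun ?_ continuous_const
    exact Continuous.matrix_det (A := fun X : M => Matrix.of X) continuous_id
  have hpos : (volume : Measure M) {X : M | (Matrix.of X).det ≠ 0} ≠ 0 :=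
    (hopen.measure_pos volume ⟨fun i j => (1 : Matrix (Fin d₁ ⊕ Fin d₂) (Fin d₁ ⊕ Fin d₂) ℝ) i j, by
      change (1 : Matrix (Fin d₁ ⊕ Fin d₂) (Fin d₁ ⊕ Fin d₂) ℝ).det ≠ 0
      simp⟩).ne'
  obtain ⟨X, hX, hX0⟩ : ∃ X : M, (Matrix.of X).det ≠ 0 ∧ μ (Prod.mk X ⁻¹' (F ⁻¹' S)) = 0 := by
    by_contra! h
    refine hpos (measure_mono_null (fun X hX => ?_) hae)
    exact h X hX
  let x : GLGroup d₁ d₂ := Matrix.GeneralLinearGroup.mkOfDetNeZero _ hX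
  have hset : Prod.mk X ⁻¹' (F ⁻¹' S) = (fun g => x * g) ⁻¹' {g : GLGroup d₁ d₂ |
      e (g : Matrix (Fin d₁ ⊕ Fin d₂) (Fin d₁ ⊕ Fin d₂) ℝ) ∈ S} := rfl
  rw [hset, measure_preimage_mul] at hX0
  refine measure_mono_null (fun g hg => ?_) hX0
  exact subset_toMeasurable volume {N | ¬ P N} hg

end HaarNull

/-! ### Almost sure properties of lattices -/

section Generic

variable {d₁ d₂ : ℕ}

/-- `y` belongs to the dual lattice of `Γ`. -/
def dualSet (Γ : Submodule ℤ (E d₁ × E d₂)) : Set (E d₁ × E d₂) :=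
  {y | ∀ γ ∈ Γ, ∃ k : ℤ, inner ℝ y.1 γ.1 + inner ℝ y.2 γ.2 = k}

theorem columnBasis_fst (g : GLGroup d₁ d₂) (j : Fin d₁ ⊕ Fin d₂) (i : Fin d₁) :
    (columnBasis g j).1 i = g.1 (Sum.inl i) j := by
  have : columnBasis g j = ∑ i, g.1 i j • stdBasis d₁ d₂ i := by
    rw [columnBasis, Basis.map_apply, Matrix.toLinearEquiv_apply, Matrix.toLin_self]
  rw [this]
  simp [stdBasis, Prod.fst_sum, Fintype.sum_sum_type, Pi.single_apply]

theorem columnBasis_snd (g : GLGroup d₁ d₂) (j : Fin d₁ ⊕ Fin d₂) (i : Fin d₂) :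
    (columnBasis g j).2 i = g.1 (Sum.inr i) j := by
  have : columnBasis g j = ∑ i, g.1 i j • stdBasis d₁ d₂ i := by
    rw [columnBasis, Basis.map_apply, Matrix.toLinearEquiv_apply, Matrix.toLin_self]
  rw [this]
  simp [stdBasis, Prod.snd_sum, Fintype.sum_sum_type, Pi.single_apply]

/-- A lattice vector with vanishing first component has integer coordinates annihilated by row `i₀`
of `g`. Almost surely this linear form has no nonzero integer zero. -/
theorem ae_projectsInjectively_latticeOf (hd₁ : 0 < d₁) :
    ∀ᵐ g : GLGroup d₁ d₂ ∂Measure.haar, ProjectsInjectively (latticeOf g) := by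
  let i₀ : Fin d₁ := ⟨0, hd₁⟩
  filter_upwards [ae_haar_of_ae_volume (ae_linear_form_ne_zero (Sum.inl i₀))
    (Matrix.ofLinearEquiv ℝ).symm] with g hg
  intro γ hγ γ' hγ' h
  rw [← sub_eq_zero]
  obtain ⟨m, hm⟩ := (Submodule.mem_span_range_iff_exists_fun ℤ).1 (sub_mem hγ hγ')
  by_cases hm0 : m = 0
  · simpa [hm0] using hm.symm
  refine absurd ?_ (hg m hm0)
  have h1 := congrArg (fun v : E d₁ × E d₂ => v.1 i₀) hm
  simpa [Prod.fst_sum, columnBasis_fst, sub_eq_zero.2 h] using h1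

/-- The dual of `g ℤⁿ` is `g⁻ᵀ ℤⁿ`, so `y.1` consists of `d₁` generic linear forms in `n = d₁ + d₂`
integers. The Borel-Cantelli condition `n < (κ + 1) d₁` is `hκ`. The finitely many exceptional
integer vectors are absorbed into `c`, because one of the forms has no nonzero integer zero. -/
theorem ae_dualSet_diophantine (hd₁ : 0 < d₁) {κ : ℝ} (hκ : (d₂ : ℝ) < κ * d₁) :
    ∀ᵐ g : GLGroup d₁ d₂ ∂Measure.haar, ∃ c : ℝ, 0 < c ∧ ∀ y ∈ dualSet (latticeOf g), y ≠ 0 →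
      c * (1 + ‖y.1‖ + ‖y.2‖) ^ (-κ) ≤ ‖y.1‖ := by
  have hκ0 : 0 ≤ κ := by
    by_contra! h
    have h1 : κ * d₁ ≤ 0 := mul_nonpos_of_nonpos_of_nonneg h.le (Nat.cast_nonneg _)
    have h2 : (0 : ℝ) ≤ d₂ := Nat.cast_nonneg _
    linarith
  let i₀ : Fin d₁ := ⟨0, hd₁⟩
  let J : Finset (Fin d₁ ⊕ Fin d₂) := Finset.univ.map Function.Embedding.inl
  have hJ : (Fintype.card (Fin d₁ ⊕ Fin d₂) : ℝ) < (κ + 1) * J.card := by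
    simp only [Fintype.card_sum, Fintype.card_fin, J, Finset.card_map, Finset.card_univ]
    push_cast
    linarith
  have h1 := ae_haar_of_ae_volume
    ((ae_linear_form_ne_zero (Sum.inl i₀)).and (ae_exists_le_linear_forms J κ hJ))
    ((Matrix.transposeLinearEquiv (Fin d₁ ⊕ Fin d₂) (Fin d₁ ⊕ Fin d₂) ℝ ℝ).trans
      (Matrix.ofLinearEquiv ℝ).symm)
  -- Inversion preserves the Haar null sets, so the generic statement, already transposed in `h1`,
  -- holds for `g⁻¹`.
  have h2 := (quasiMeasurePreserving_inv (Measure.haar : Measure (GLGroup d₁ d₂))).ae h1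
  filter_upwards [h2] with g ⟨hg1, hg2⟩
  let f : (Fin d₁ ⊕ Fin d₂ → ℤ) → Fin d₁ ⊕ Fin d₂ → ℝ := fun m i => ∑ j, m j * (g⁻¹).1 j i
  change ∀ m, m ≠ 0 → f m (Sum.inl i₀) ≠ 0 at hg1
  change {m | m ≠ 0 ∧ ∀ i ∈ J, |f m i| ≤ (1 + ‖m‖) ^ (-κ)}.Finite at hg2
  obtain ⟨c, hc, hcm⟩ : ∃ c : ℝ, 0 < c ∧
      ∀ m ∈ {m | m ≠ 0 ∧ ∀ i ∈ J, |f m i| ≤ (1 + ‖m‖) ^ (-κ)}, c ≤ |f m (Sum.inl i₀)| := by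
    rcases Set.eq_empty_or_nonempty {m | m ≠ 0 ∧ ∀ i ∈ J, |f m i| ≤ (1 + ‖m‖) ^ (-κ)} with h | h
    · exact ⟨1, one_pos, fun m hm => absurd (h ▸ hm) (Set.notMem_empty m)⟩
    · obtain ⟨m, hm, hmin⟩ := Set.exists_min_image _ (fun m => |f m (Sum.inl i₀)|) hg2 h
      exact ⟨_, abs_pos.2 (hg1 m hm.1), hmin⟩
  let A : ℝ := ∑ j, (‖(columnBasis g j).1‖ + ‖(columnBasis g j).2‖)
  have hA : 0 ≤ A := Finset.sum_nonneg fun _ _ => by positivity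
  -- The constant `c` serves the exceptional vectors. For the others, `‖m‖ ≤ A (‖y.1‖ + ‖y.2‖)`
  -- turns the bound in `‖m‖` into one in `y`, at the cost of `(1 + A) ^ (-κ)`.
  refine ⟨min c ((1 + A) ^ (-κ)), lt_min hc (by positivity), fun y hy hy0 => ?_⟩
  have hy' : ∀ j, ∃ k : ℤ, inner ℝ y.1 (columnBasis g j).1 + inner ℝ y.2 (columnBasis g j).2 = k :=
    fun j => hy _ (Submodule.subset_span ⟨j, rfl⟩)
  choose m hm using hy'
  let Y : Fin d₁ ⊕ Fin d₂ → ℝ := Sum.elim (fun i => y.1 i) fun i => y.2 i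
  have hYm : Matrix.vecMul Y g.1 = fun j => (m j : ℝ) := by
    ext j
    rw [← hm]
    simp [Matrix.vecMul, dotProduct, Fintype.sum_sum_type, Y, PiLp.inner_apply, columnBasis_fst,
      columnBasis_snd, mul_comm]
  have hY : ∀ i, Y i = f m i := by
    have : Matrix.vecMul (Matrix.vecMul Y g.1) (g⁻¹).1 = Y := by
      rw [Matrix.vecMul_vecMul]
      have : g.1 * (g⁻¹).1 = 1 := Units.mul_inv g
      rw [this, Matrix.vecMul_one]
    intro i
    conv_lhs => rw [← this, hYm]
    rfl
  have hm0 : m ≠ 0 := by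
    intro h
    refine hy0 (Prod.ext ?_ ?_)
    · ext i
      simpa [f, h, Y] using hY (Sum.inl i)
    · ext i
      simpa [f, h, Y] using hY (Sum.inr i)
  have hcoord : ∀ i : Fin d₁, |f m (Sum.inl i)| ≤ ‖y.1‖ := fun i => by
    rw [← hY]
    exact PiLp.norm_apply_le y.1 i
  have hbase : (1 : ℝ) ≤ 1 + ‖y.1‖ + ‖y.2‖ := by
    linarith [norm_nonneg y.1, norm_nonneg y.2]
  by_cases hmF : ∀ i ∈ J, |f m i| ≤ (1 + ‖m‖) ^ (-κ)
  · calc _ ≤ c * 1 := mul_le_mul (min_le_left _ _)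
          (Real.rpow_le_one_of_one_le_of_nonpos hbase (by linarith)) (by positivity) hc.le
      _ ≤ _ := by
        rw [mul_one]
        exact (hcm m ⟨hm0, hmF⟩).trans (hcoord i₀)
  · push Not at hmF
    obtain ⟨i, hi, him⟩ := hmF
    obtain ⟨i, -, rfl⟩ := Finset.mem_map.1 hi
    have hnm : ‖m‖ ≤ A * (‖y.1‖ + ‖y.2‖) := by
      refine (pi_norm_le_iff_of_nonneg (by positivity)).2 fun j => ?_
      rw [Int.norm_eq_abs, ← hm]
      have e1 := abs_real_inner_le_norm y.1 (columnBasis g j).1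
      have e2 := abs_real_inner_le_norm y.2 (columnBasis g j).2
      have e3 : ‖(columnBasis g j).1‖ + ‖(columnBasis g j).2‖ ≤ A :=
        Finset.single_le_sum (f := fun j => ‖(columnBasis g j).1‖ + ‖(columnBasis g j).2‖)
          (fun _ _ => by positivity) (Finset.mem_univ j)
      have e4 : ‖(columnBasis g j).1‖ ≤ A := by linarith [norm_nonneg (columnBasis g j).2]
      have e5 : ‖(columnBasis g j).2‖ ≤ A := by linarith [norm_nonneg (columnBasis g j).1]
      calc _ ≤ _ := abs_add_le _ _
        _ ≤ ‖y.1‖ * A + ‖y.2‖ * A := by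
          gcongr
          · exact e1.trans (by gcongr)
          · exact e2.trans (by gcongr)
        _ = _ := by ring
    calc _ ≤ (1 + A) ^ (-κ) * (1 + ‖y.1‖ + ‖y.2‖) ^ (-κ) := by
          gcongr
          exact min_le_right _ _
      _ = ((1 + A) * (1 + ‖y.1‖ + ‖y.2‖)) ^ (-κ) := (Real.mul_rpow (by positivity) (by positivity)).symm
      _ ≤ (1 + ‖m‖) ^ (-κ) := by
        refine Real.rpow_le_rpow_of_nonpos (by positivity) ?_ (by linarith)
        nlinarith [norm_nonneg y.1, norm_nonneg y.2]
      _ ≤ _ := him.le.trans (hcoord i)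

end Generic

/-! ### Parseval's identity on a fundamental domain -/

section Parseval

variable {V ι : Type*} [NormedAddCommGroup V] [NormedSpace ℝ V] [Fintype ι]

noncomputable local instance instMeasureSpaceUnitAddCircle : MeasureSpace UnitAddCircle :=
  ⟨AddCircle.haarAddCircle⟩

/-- The inverse of the coordinate map of the torus, with values in the fundamental domain. -/
noncomputable def torusSection (b : Basis ι ℝ V) (x : UnitAddTorus ι) : V :=
  b.equivFunL.symm (UnitAddTorus.measurableEquivPiIoc (0 : ι → ℝ) x).1

theorem torusSection_repr (b : Basis ι ℝ V) (x : UnitAddTorus ι) (i : ι) :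
    ((b.repr (torusSection b x) i : ℝ) : UnitAddCircle) = x i := by
  have h := congrFun ((UnitAddTorus.measurableEquivPiIoc (0 : ι → ℝ)).symm_apply_apply x) i
  rw [UnitAddTorus.coe_symm_measurableEquivPiIoc] at h
  rw [← h, ← Basis.equivFun_apply]
  congr 1
  exact congrFun (b.equivFunL.apply_symm_apply _) i

variable [MeasurableSpace V] [BorelSpace V]

/-- Two Haar measures are proportional, and total mass one on the fundamental domain fixes the
factor. The cube is half-open on the other side than the fundamental domain, which changes only a
null set. -/
theorem map_equivFun_symm_restrict_cube (b : Basis ι ℝ V) (μ : Measure V) [μ.IsAddHaarMeasure] :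
    (volume.restrict {x : ι → ℝ | ∀ i, x i ∈ Ioc ((0 : ι → ℝ) i) ((0 : ι → ℝ) i + 1)}).map
      b.equivFunL.symm = (μ (ZSpan.fundamentalDomain b))⁻¹ • μ.restrict (ZSpan.fundamentalDomain b) := by
  have := b.finiteDimensional_of_finite
  let ν : Measure V := volume.map b.equivFunL.symm
  have hν : ν.IsAddHaarMeasure := b.equivFunL.symm.isAddHaarMeasure_map volume
  have hpre : b.equivFunL.symm ⁻¹' ZSpan.fundamentalDomain b =
      Set.pi univ fun _ => Ico (0 : ℝ) 1 := by
    ext x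
    have h : ∀ i, b.repr (b.equivFunL.symm x) i = x i := congrFun (b.equivFunL.apply_symm_apply x)
    simp only [Set.mem_preimage, ZSpan.mem_fundamentalDomain, Set.mem_pi, Set.mem_univ, h,
      true_imp_iff]
  have hcube : {x : ι → ℝ | ∀ i, x i ∈ Ioc ((0 : ι → ℝ) i) ((0 : ι → ℝ) i + 1)} =ᵐ[volume]
      b.equivFunL.symm ⁻¹' ZSpan.fundamentalDomain b := by
    rw [hpre]
    have h1 : {x : ι → ℝ | ∀ i, x i ∈ Ioc ((0 : ι → ℝ) i) ((0 : ι → ℝ) i + 1)} =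
        Set.pi univ fun _ => Ioc (0 : ℝ) 1 := by
      ext x
      simp [Set.mem_pi]
    rw [h1]
    exact (Measure.univ_pi_Ioc_ae_eq_Icc (f := fun _ : ι => (0 : ℝ)) (g := fun _ => 1)).trans
      (Measure.univ_pi_Ico_ae_eq_Icc (f := fun _ : ι => (0 : ℝ)) (g := fun _ => 1)).symm
  have hνD : ν (ZSpan.fundamentalDomain b) = 1 := by
    rw [Measure.map_apply b.equivFunL.symm.continuous.measurable
      (ZSpan.fundamentalDomain_measurableSet b), hpre, volume_pi_pi]
    simp
  have hνμ := Measure.isAddLeftInvariant_eq_smul ν μ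
  have hfac : (Measure.addHaarScalarFactor ν μ : ℝ≥0∞) = (μ (ZSpan.fundamentalDomain b))⁻¹ := by
    refine ENNReal.eq_inv_of_mul_eq_one_left ?_
    have h := congrArg (fun m : Measure V => m (ZSpan.fundamentalDomain b)) hνμ
    rw [hνD] at h
    exact h.symm
  rw [Measure.restrict_congr_set hcube, ← Measure.restrict_map
    b.equivFunL.symm.continuous.measurable (ZSpan.fundamentalDomain_measurableSet b)]
  change ν.restrict _ = _
  rw [hνμ, Measure.restrict_smul, ← hfac]
  rfl

theorem measurePreserving_torusSection (b : Basis ι ℝ V) (μ : Measure V) [μ.IsAddHaarMeasure] :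
    MeasurePreserving (torusSection b) volume
      ((μ (ZSpan.fundamentalDomain b))⁻¹ • μ.restrict (ZSpan.fundamentalDomain b)) := by
  have h1 := UnitAddTorus.measurePreserving_equivPiIoc (0 : ι → ℝ)
  have h2 := measurePreserving_subtype_coe (μa := (volume : Measure (ι → ℝ)))
    (s := {x : ι → ℝ | ∀ i, x i ∈ Ioc ((0 : ι → ℝ) i) ((0 : ι → ℝ) i + 1)}) (by measurability)
  have h3 : MeasurePreserving b.equivFunL.symm _ _ :=
    ⟨b.equivFunL.symm.continuous.measurable, map_equivFun_symm_restrict_cube b μ⟩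
  exact h3.comp (h2.comp h1)

theorem measurableEmbedding_torusSection (b : Basis ι ℝ V) :
    MeasurableEmbedding (torusSection b) := by
  have h2 : MeasurableEmbedding (Subtype.val : {x : ι → ℝ | ∀ i, x i ∈
      Ioc ((0 : ι → ℝ) i) ((0 : ι → ℝ) i + 1)} → ι → ℝ) :=
    MeasurableEmbedding.subtype_coe (by measurability)
  exact b.equivFunL.symm.toHomeomorph.measurableEmbedding.comp
    (h2.comp (UnitAddTorus.measurableEquivPiIoc (0 : ι → ℝ)).measurableEmbedding)

/-- Parseval's identity for functions on the fundamental domain of a lattice. -/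
theorem hasSum_sq_fourierCoeff_fundamentalDomain (b : Basis ι ℝ V) (μ : Measure V)
    [μ.IsAddHaarMeasure] {F : V → ℂ} (hF : MemLp F 2 (μ.restrict (ZSpan.fundamentalDomain b))) :
    HasSum (fun m : ι → ℤ => ‖∫ v in ZSpan.fundamentalDomain b,
        Complex.exp (-(2 * Real.pi * Complex.I * (∑ i, m i * b.repr v i : ℝ))) * F v ∂μ‖ ^ 2)
      (μ.real (ZSpan.fundamentalDomain b) * ∫ v in ZSpan.fundamentalDomain b, ‖F v‖ ^ 2 ∂μ) := by
  have := b.finiteDimensional_of_finite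
  set D := ZSpan.fundamentalDomain b
  have hc0 : μ D ≠ 0 := ZSpan.measure_fundamentalDomain_ne_zero b
  have hct : μ D ≠ ⊤ := (ZSpan.fundamentalDomain_isBounded b).measure_lt_top.ne
  have hT := measurePreserving_torusSection b μ
  have hTe := measurableEmbedding_torusSection b
  have hint : ∀ {G : V → ℂ}, ∫ x, G (torusSection b x) = ((μ.real D)⁻¹ : ℝ) • ∫ v in D, G v ∂μ := by
    intro G
    rw [hT.integral_comp hTe, integral_smul_measure, ENNReal.toReal_inv]
    rfl
  have hintR : ∀ {G : V → ℝ}, ∫ x, G (torusSection b x) = (μ.real D)⁻¹ * ∫ v in D, G v ∂μ := by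
    intro G
    rw [hT.integral_comp hTe, integral_smul_measure, ENNReal.toReal_inv]
    rfl
  have hmem : MemLp (F ∘ torusSection b) 2 volume :=
    (hF.smul_measure (ENNReal.inv_ne_top.2 hc0)).comp_measurePreserving hT
  have hP := UnitAddTorus.hasSum_sq_mFourierCoeff (hmem.toLp _)
  have hpos : 0 < μ.real D := ENNReal.toReal_pos hc0 hct
  have hR : ∫ t, ‖hmem.toLp _ t‖ ^ 2 = (μ.real D)⁻¹ * ∫ v in D, ‖F v‖ ^ 2 ∂μ := by
    rw [← hintR]
    refine integral_congr_ae ?_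
    filter_upwards [hmem.coeFn_toLp] with t ht
    rw [ht]
    rfl
  have hL : ∀ m, UnitAddTorus.mFourierCoeff (hmem.toLp _) m = ((μ.real D)⁻¹ : ℝ) • ∫ v in D,
      Complex.exp (-(2 * Real.pi * Complex.I * (∑ i, m i * b.repr v i : ℝ))) * F v ∂μ := by
    intro m
    rw [← hint]
    refine integral_congr_ae ?_
    filter_upwards [hmem.coeFn_toLp] with t ht
    rw [ht, smul_eq_mul, Function.comp_apply]
    congr 1
    simp only [UnitAddTorus.mFourier, ContinuousMap.coe_mk]
    rw [Complex.ofReal_sum, Finset.mul_sum, ← Finset.sum_neg_distrib, Complex.exp_sum]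
    refine Finset.prod_congr rfl fun i _ => ?_
    conv_lhs => rw [← torusSection_repr b t i, fourier_coe_apply]
    congr 1
    push_cast [Pi.neg_apply]
    ring
  simp_rw [hL, norm_smul, mul_pow] at hP
  rw [hR] at hP
  -- On the torus each squared coefficient carries `(μ D)⁻²` and the mean square carries `(μ D)⁻¹`;
  -- this factor clears both.
  have h3 := hP.mul_left ((μ.real D) ^ 2)
  have e1 : ∀ x : ℝ, μ.real D ^ 2 * (‖(μ.real D)⁻¹‖ ^ 2 * x) = x := fun x => by
    rw [Real.norm_of_nonneg (by positivity)]
    field_simp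
  have e2 : ∀ x : ℝ, μ.real D ^ 2 * ((μ.real D)⁻¹ * x) = μ.real D * x := fun x => by
    field_simp
  simpa only [e1, e2] using h3

end Parseval

/-! ### Periodization and the Poisson summation formula -/

section Periodization

variable {V : Type*} [NormedAddCommGroup V] [NormedSpace ℝ V] [FiniteDimensional ℝ V]
  (L : Submodule ℤ V) [DiscreteTopology L]

theorem lattice_finite_inter {K : Set V} (hK : Bornology.IsBounded K) :
    {γ : L | (γ : V) ∈ K}.Finite := by
  have : ProperSpace V := FiniteDimensional.proper ℝ V
  have : DiscreteTopology L.toAddSubgroup := inferInstanceAs (DiscreteTopology L)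
  have hcl : IsClosed (L.toAddSubgroup : Set V) := AddSubgroup.isClosed_of_discrete
  have h := Metric.finite_isBounded_inter_isClosed (s := (L.toAddSubgroup : Set V))
    DiscreteTopology.isDiscrete hK hcl
  exact (h.preimage (f := ((↑) : L → V)) Subtype.val_injective.injOn).subset
    fun γ hγ => ⟨hγ, γ.2⟩

/-- Such lattice vectors lie in the bounded set `K - K'`. On bounded sets, a periodization thereby
becomes a finite sum with one index set for all points. -/
theorem lattice_finite_translates {K K' : Set V} (hK : Bornology.IsBounded K)
    (hK' : Bornology.IsBounded K') : {γ : L | ∃ v ∈ K', (γ : V) + v ∈ K}.Finite := by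
  refine (lattice_finite_inter L (hK.sub hK')).subset ?_
  rintro γ ⟨v, hv, h⟩
  exact ⟨_, h, v, hv, by simp⟩

/-- The sum of the translates of `φ` by the elements of a lattice. -/
noncomputable def periodization (φ : V → ℂ) (v : V) : ℂ := ∑' γ : L, φ (γ + v)

variable {L} {φ : V → ℂ} {K : Set V}

theorem periodization_eq_sum (hφK : ∀ v ∉ K, φ v = 0) {K' : Set V} {s : Finset L}
    (hs : ∀ γ : L, (∃ v ∈ K', (γ : V) + v ∈ K) → γ ∈ s) {v : V} (hv : v ∈ K') :
    periodization L φ v = ∑ γ ∈ s, φ (γ + v) :=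
  tsum_eq_sum fun γ hγ => hφK _ fun h => hγ (hs γ ⟨v, hv, h⟩)

variable [IsZLattice ℝ L] [MeasurableSpace V] [BorelSpace V] {μ : Measure V} [μ.IsAddHaarMeasure]
  {D : Set V}

instance instVAddInvariantMeasureLattice (L : Submodule ℤ V) (μ : Measure V) [μ.IsAddHaarMeasure] :
    VAddInvariantMeasure L V μ :=
  inferInstanceAs (VAddInvariantMeasure L.toAddSubgroup V μ)

theorem integral_tsum_fundamentalDomain (hD : IsAddFundamentalDomain L D μ) {G : V → ℂ}
    (hG : Integrable G μ) : ∫ v in D, ∑' γ : L, G (γ + v) ∂μ = ∫ v, G v ∂μ := by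
  rw [hD.integral_eq_tsum'' G hG]
  have hmp : ∀ γ : L, MeasurePreserving (fun v => (γ : V) + v) μ μ := fun γ =>
    measurePreserving_add_left μ _
  refine integral_tsum (fun γ => ?_) ?_
  · exact (hG.1.comp_measurePreserving (hmp γ)).restrict
  · have := hD.lintegral_eq_tsum'' fun v => ‖G v‖ₑ
    exact (this.symm.trans_lt hG.2).ne

/-- Unfolding: the translates of `D` tile the space, and the periodic factor `ψ` passes through the
lattice sum. -/
theorem integral_mul_periodization (hD : IsAddFundamentalDomain L D μ) {ψ : V → ℂ}
    (hψ : ∀ (γ : L) v, ψ (γ + v) = ψ v) (hφ : Integrable (fun v => ψ v * φ v) μ) :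
    ∫ v in D, ψ v * periodization L φ v ∂μ = ∫ v, ψ v * φ v ∂μ := by
  rw [← integral_tsum_fundamentalDomain hD hφ]
  simp_rw [hψ, tsum_mul_left]
  rfl

theorem periodization_add (φ : V → ℂ) (γ : L) (v : V) :
    periodization L φ (γ + v) = periodization L φ v := by
  rw [periodization, ← (Equiv.subRight γ).tsum_eq]
  refine tsum_congr fun β => ?_
  simp [← add_assoc]

theorem memLp_bounded_support (hφ : Measurable φ) {B : ℝ} (hB : ∀ v, ‖φ v‖ ≤ B)
    (hK : Bornology.IsBounded K) (hφK : ∀ v ∉ K, φ v = 0) (p : ℝ≥0∞) : MemLp φ p μ := by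
  have : ProperSpace V := FiniteDimensional.proper ℝ V
  have hsupp : HasCompactSupport φ := by
    refine HasCompactSupport.of_support_subset_isCompact hK.isCompact_closure fun v hv => ?_
    by_contra h
    exact hv (hφK v fun h' => h (subset_closure h'))
  exact hsupp.memLp_of_bound hφ.aestronglyMeasurable B (Eventually.of_forall hB)

theorem memLp_periodization (hDm : MeasurableSet D) (hDb : Bornology.IsBounded D)
    (hφ : Measurable φ) {B : ℝ} (hB : ∀ v, ‖φ v‖ ≤ B)
    (hK : Bornology.IsBounded K) (hφK : ∀ v ∉ K, φ v = 0) :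
    MemLp (periodization L φ) 2 (μ.restrict D) := by
  have hfin := lattice_finite_translates L hK hDb
  have h1 : MemLp (fun v => ∑ γ ∈ hfin.toFinset, φ (γ + v)) 2 (μ.restrict D) := by
    refine memLp_finsetSum _ fun γ _ => ?_
    exact ((memLp_bounded_support hφ hB hK hφK 2).comp_measurePreserving
      (measurePreserving_add_left μ (γ : V))).restrict D
  refine h1.ae_eq ?_
  filter_upwards [ae_restrict_mem hDm] with v hv
  exact (periodization_eq_sum hφK (fun γ h => hfin.mem_toFinset.2 h) hv).symm

/-- One factor of the square is unfolded against the other. On the support of `φ` the remaining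
periodization is a finite sum, so it can be exchanged with the integral. -/
theorem integral_norm_sq_periodization (hD : IsAddFundamentalDomain L D μ)
    (hφ : Measurable φ) {B : ℝ} (hB : ∀ v, ‖φ v‖ ≤ B)
    (hK : Bornology.IsBounded K) (hφK : ∀ v ∉ K, φ v = 0) :
    ((∫ v in D, ‖periodization L φ v‖ ^ 2 ∂μ : ℝ) : ℂ) =
      ∑' β : L, ∫ v, φ v * starRingEnd ℂ (φ (v - β)) ∂μ := by
  have hfin := lattice_finite_translates L hK hK
  let s : Finset L := hfin.toFinset
  have hm : ∀ β : L, MemLp (fun v => φ (β + v)) 2 μ := fun β =>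
    (memLp_bounded_support hφ hB hK hφK 2).comp_measurePreserving
      (measurePreserving_add_left μ (β : V))
  have hint : ∀ β : L, Integrable (fun v => starRingEnd ℂ (φ (β + v)) * φ v) μ := fun β =>
    MemLp.integrable_mul (hm β).star (memLp_bounded_support hφ hB hK hφK 2)
  have hpt : ∀ v, starRingEnd ℂ (periodization L φ v) * φ v =
      ∑ β ∈ s, starRingEnd ℂ (φ (β + v)) * φ v := by
    intro v
    by_cases hv : v ∈ K
    · rw [periodization_eq_sum hφK (fun γ h => hfin.mem_toFinset.2 h) hv, map_sum, Finset.sum_mul]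
    · simp [hφK v hv]
  have h1 : ((∫ v in D, ‖periodization L φ v‖ ^ 2 ∂μ : ℝ) : ℂ) =
      ∫ v in D, starRingEnd ℂ (periodization L φ v) * periodization L φ v ∂μ := by
    rw [← integral_complex_ofReal]
    refine integral_congr_ae (Eventually.of_forall fun v => ?_)
    simp only [Complex.conj_mul']
    push_cast
    rfl
  rw [h1, integral_mul_periodization hD (fun γ v => by rw [periodization_add])]
  · simp_rw [hpt]
    rw [integral_finsetSum _ fun β _ => hint β, ← (Equiv.neg L).tsum_eq, tsum_eq_sum (s := s)]
    · refine Finset.sum_congr rfl fun β _ => integral_congr_ae (Eventually.of_forall fun v => ?_)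
      simp [mul_comm, add_comm]
    · intro β hβ
      refine integral_eq_zero_of_ae (Eventually.of_forall fun v => ?_)
      by_cases hv : v ∈ K
      · have : (β : V) + v ∉ K := fun h => hβ (hfin.mem_toFinset.2 ⟨v, hv, h⟩)
        simp [hφK _ this, add_comm v]
      · simp [hφK _ hv]
  · simp_rw [hpt]
    exact integrable_finsetSum _ fun β _ => hint β

/-- The character sums of `φ` over the dual lattice, in coordinates with respect to a basis of the
lattice. -/
theorem hasSum_sq_fourierIntegral {ι : Type*} [Fintype ι] (b : Basis ι ℝ V)
    (hbL : Submodule.span ℤ (range b) = L)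
    (hφ : Measurable φ) {B : ℝ} (hB : ∀ v, ‖φ v‖ ≤ B)
    (hK : Bornology.IsBounded K) (hφK : ∀ v ∉ K, φ v = 0) :
    ∃ A : ℝ, (A : ℂ) = ∑' β : L, ∫ v, φ v * starRingEnd ℂ (φ (v - β)) ∂μ ∧
    HasSum (fun m : ι → ℤ => ‖∫ v,
        Complex.exp (-(2 * Real.pi * Complex.I * (∑ i, m i * b.repr v i : ℝ))) * φ v ∂μ‖ ^ 2)
      (μ.real (ZSpan.fundamentalDomain b) * A) := by
  subst hbL
  set D := ZSpan.fundamentalDomain b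
  have hD : IsAddFundamentalDomain (Submodule.span ℤ (range b)) D μ :=
    ZSpan.isAddFundamentalDomain b μ
  -- The witness is the squared `L²` norm of the periodization over `D`. Unfolding gives its lattice
  -- side and Parseval its dual side. Working in `L²` requires no continuity of `φ`, which matters
  -- for the indicator function of a window.
  refine ⟨_, integral_norm_sq_periodization hD hφ hB hK hφK, ?_⟩
  have h := hasSum_sq_fourierCoeff_fundamentalDomain b μ (memLp_periodization
    (L := Submodule.span ℤ (range b))
    (ZSpan.fundamentalDomain_measurableSet b) (ZSpan.fundamentalDomain_isBounded b) hφ hB hK hφK)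
  refine HasSum.congr_fun h fun m => ?_
  rw [integral_mul_periodization hD]
  · rintro ⟨γ, hγ⟩ v
    obtain ⟨k, hk⟩ : ∃ k : ℤ, ∑ i, m i * b.repr γ i = (k : ℝ) := by
      have hr := (b.mem_span_iff_repr_mem ℤ γ).1 hγ
      choose z hz using hr
      refine ⟨∑ i, m i * z i, ?_⟩
      push_cast
      refine Finset.sum_congr rfl fun i _ => ?_
      rw [← hz i]
      rfl
    have : ∑ i, m i * b.repr (γ + v) i = k + ∑ i, m i * b.repr v i := by
      rw [← hk, ← Finset.sum_add_distrib]
      simp [mul_add]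
    simp only [this]
    rw [Complex.exp_eq_exp_iff_exists_int]
    refine ⟨-k, ?_⟩
    push_cast
    ring
  · refine Integrable.bdd_mul (c := 1) ?_ ?_ (Eventually.of_forall fun v => ?_)
    · exact (memLp_one_iff_integrable.1 (memLp_bounded_support hφ hB hK hφK 1))
    · refine Continuous.aestronglyMeasurable ?_
      have : ∀ i, Continuous fun v => b.repr v i := fun i =>
        (b.coord i).continuous_of_finiteDimensional
      fun_prop
    · have : -(2 * Real.pi * Complex.I * (∑ i, m i * b.repr v i : ℝ)) =
          ((-(2 * Real.pi * ∑ i, m i * b.repr v i) : ℝ) : ℂ) * Complex.I := by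
        push_cast
        ring
      rw [this, Complex.norm_exp_ofReal_mul_I]

end Periodization

/-! ### Measures are determined by the integrals of `|f̂|²` -/

section Uniqueness

variable {d : ℕ}

theorem continuous_fourier_of_compactSupport {f : E d → ℂ} (hf : Continuous f)
    (hfc : HasCompactSupport f) : Continuous (𝓕 f) :=
  VectorFourier.fourierIntegral_continuous Real.continuous_fourierChar
    (by exact continuous_inner) (hf.integrable_of_hasCompactSupport hfc)

theorem fourier_apply_exp (f : E d → ℂ) (ξ : E d) :
    𝓕 f ξ = ∫ x, Complex.exp (-(2 * Real.pi * Complex.I * (inner ℝ x ξ : ℝ))) * f x := by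
  rw [Real.fourier_eq']
  refine integral_congr_ae (Eventually.of_forall fun x => ?_)
  simp only [smul_eq_mul]
  congr 2
  push_cast
  ring

/-- A bump function multiplied by the character of frequency `ξ` has the integral of the bump as its
transform at `ξ`. -/
theorem exists_fourier_ne_zero (ξ : E d) :
    ∃ f : E d → ℂ, Continuous f ∧ HasCompactSupport f ∧ 𝓕 f ξ ≠ 0 := by
  let φ : ContDiffBump (0 : E d) := ⟨1, 2, one_pos, one_lt_two⟩
  refine ⟨fun x => Complex.exp (2 * Real.pi * Complex.I * (inner ℝ x ξ : ℝ)) * (φ x : ℂ), ?_, ?_, ?_⟩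
  · have := φ.continuous
    fun_prop
  · exact (φ.hasCompactSupport.comp_left (g := Complex.ofReal) rfl).mul_left
  · rw [fourier_apply_exp]
    have : ∀ x : E d, Complex.exp (-(2 * Real.pi * Complex.I * (inner ℝ x ξ : ℝ))) *
        (Complex.exp (2 * Real.pi * Complex.I * (inner ℝ x ξ : ℝ)) * (φ x : ℂ)) = (φ x : ℂ) := by
      intro x
      rw [← mul_assoc, ← Complex.exp_add]
      simp
    simp_rw [this]
    rw [integral_complex_ofReal]
    exact_mod_cast φ.integral_pos.ne'

/-- Used for polarization: for `‖c‖ = 1` the squared modulus of the first factor is `2 + 2 Re (c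
e^(-2πi⟨a, ξ⟩))`, which exposes a character. -/
theorem fourier_add_mul_translate {f : E d → ℂ} (hf : Continuous f) (hfc : HasCompactSupport f)
    (c : ℂ) (a ξ : E d) :
    𝓕 (fun x => f x + c * f (x - a)) ξ =
      (1 + c * Complex.exp (-(2 * Real.pi * Complex.I * (inner ℝ a ξ : ℝ)))) * 𝓕 f ξ := by
  simp only [fourier_apply_exp]
  have hi : ∀ g : E d → ℂ, Continuous g → HasCompactSupport g →
      Integrable fun x => Complex.exp (-(2 * Real.pi * Complex.I * (inner ℝ x ξ : ℝ))) * g x :=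
    fun g hg hgc => Continuous.integrable_of_hasCompactSupport (by fun_prop) hgc.mul_left
  have hfa : HasCompactSupport fun x => f (x - a) :=
    hfc.comp_homeomorph (Homeomorph.subRight a)
  have h1 : ∫ x, Complex.exp (-(2 * Real.pi * Complex.I * (inner ℝ x ξ : ℝ))) * f (x - a) =
      Complex.exp (-(2 * Real.pi * Complex.I * (inner ℝ a ξ : ℝ))) *
        ∫ x, Complex.exp (-(2 * Real.pi * Complex.I * (inner ℝ x ξ : ℝ))) * f x := by
    rw [← integral_add_right_eq_self _ a, ← integral_const_mul]
    refine integral_congr_ae (Eventually.of_forall fun x => ?_)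
    simp only [add_sub_cancel_right, inner_add_left]
    rw [← mul_assoc, ← Complex.exp_add]
    congr 2
    push_cast
    ring
  simp_rw [mul_add, mul_left_comm _ c]
  rw [integral_add (hi f hf hfc) ((hi _ (by fun_prop) hfa).const_mul c), integral_const_mul, h1]
  ring

/-- A locally finite measure is determined by the integrals of `|f̂|²`. -/
theorem eq_of_integral_fourier_sq_eq {σ τ : Measure (E d)}
    (hσ : ∀ f : E d → ℂ, Continuous f → HasCompactSupport f →
      Integrable (fun ξ => ‖𝓕 f ξ‖ ^ 2) σ)
    (hτ : ∀ f : E d → ℂ, Continuous f → HasCompactSupport f →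
      Integrable (fun ξ => ‖𝓕 f ξ‖ ^ 2) τ)
    (h : ∀ f : E d → ℂ, Continuous f → HasCompactSupport f →
      ∫ ξ, ‖𝓕 f ξ‖ ^ 2 ∂σ = ∫ ξ, ‖𝓕 f ξ‖ ^ 2 ∂τ) : τ = σ := by
  have hden : ∀ f : E d → ℂ, Continuous f → HasCompactSupport f →
      τ.withDensity (fun ξ => ENNReal.ofReal (‖𝓕 f ξ‖ ^ 2)) =
        σ.withDensity fun ξ => ENNReal.ofReal (‖𝓕 f ξ‖ ^ 2) := by
    intro f hf hfc
    have hc := continuous_fourier_of_compactSupport hf hfc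
    have := isFiniteMeasure_withDensity_ofReal (hσ f hf hfc).2
    have := isFiniteMeasure_withDensity_ofReal (hτ f hf hfc).2
    -- Testing with `f + c f(· - a)` as well as `f` isolates the integral of `|f̂|²` against `Re (c
    -- e^(-2πi⟨a, ξ⟩))`. The values `c = 1` and `c = -i` yield the real and imaginary parts of the
    -- characteristic functions.
    have key : ∀ (c : ℂ) (a : E d), ‖c‖ = 1 →
        ∫ ξ, ‖𝓕 f ξ‖ ^ 2 * (c * Complex.exp (-(2 * Real.pi * Complex.I * (inner ℝ a ξ : ℝ)))).re ∂σ =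
        ∫ ξ, ‖𝓕 f ξ‖ ^ 2 * (c * Complex.exp (-(2 * Real.pi * Complex.I * (inner ℝ a ξ : ℝ)))).re ∂τ := by
      intro c a hc1
      have hg : Continuous fun x => f x + c * f (x - a) := by fun_prop
      have hgc : HasCompactSupport fun x => f x + c * f (x - a) :=
        hfc.add (hfc.comp_homeomorph (Homeomorph.subRight a)).mul_left
      have e : ∀ ξ, ‖𝓕 f ξ‖ ^ 2 *
          (c * Complex.exp (-(2 * Real.pi * Complex.I * (inner ℝ a ξ : ℝ)))).re =
          (1 / 2) * ‖𝓕 (fun x => f x + c * f (x - a)) ξ‖ ^ 2 - ‖𝓕 f ξ‖ ^ 2 := by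
        intro ξ
        rw [fourier_add_mul_translate hf hfc, norm_mul, mul_pow]
        set w := c * Complex.exp (-(2 * Real.pi * Complex.I * (inner ℝ a ξ : ℝ))) with hw
        have hw1 : ‖w‖ = 1 := by
          rw [hw, norm_mul, hc1, one_mul]
          have : -(2 * Real.pi * Complex.I * (inner ℝ a ξ : ℝ)) =
            ((-(2 * Real.pi * inner ℝ a ξ) : ℝ) : ℂ) * Complex.I := by
              push_cast
              ring
          rw [this, Complex.norm_exp_ofReal_mul_I]
        have hw2 : ‖1 + w‖ ^ 2 = 2 + 2 * w.re := by
          have h1 : w.re * w.re + w.im * w.im = 1 := by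
            rw [← Complex.normSq_apply, Complex.normSq_eq_norm_sq, hw1, one_pow]
          rw [← Complex.normSq_eq_norm_sq, Complex.normSq_apply]
          simp only [Complex.add_re, Complex.one_re, Complex.add_im, Complex.one_im]
          linarith
        rw [hw2]
        ring
      simp_rw [e]
      rw [integral_sub ((hσ _ hg hgc).const_mul _) (hσ f hf hfc),
        integral_sub ((hτ _ hg hgc).const_mul _) (hτ f hf hfc), integral_const_mul,
        integral_const_mul, h _ hg hgc, h f hf hfc]
    refine Measure.ext_of_charFun (funext fun t => ?_)
    have hm : Measurable fun ξ => ENNReal.ofReal (‖𝓕 f ξ‖ ^ 2) :=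
      ENNReal.measurable_ofReal.comp (by fun_prop)
    have hlt : ∀ ν : Measure (E d), ∀ᵐ ξ ∂ν, ENNReal.ofReal (‖𝓕 f ξ‖ ^ 2) < ⊤ := fun ν =>
      Eventually.of_forall fun _ => ENNReal.ofReal_lt_top
    rw [charFun_apply, charFun_apply, integral_withDensity_eq_integral_toReal_smul hm (hlt _),
      integral_withDensity_eq_integral_toReal_smul hm (hlt _)]
    have hI : ∀ ν : Measure (E d), Integrable (fun ξ => ‖𝓕 f ξ‖ ^ 2) ν → Integrable (fun ξ =>
        (ENNReal.ofReal (‖𝓕 f ξ‖ ^ 2)).toReal • Complex.exp (inner ℝ ξ t * Complex.I)) ν := by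
      intro ν hν
      simp_rw [ENNReal.toReal_ofReal (sq_nonneg _)]
      refine hν.mono' (hν.1.smul (Continuous.aestronglyMeasurable (by fun_prop)))
        (Eventually.of_forall fun ξ => ?_)
      rw [norm_smul, Complex.norm_exp_ofReal_mul_I, mul_one, Real.norm_of_nonneg (sq_nonneg _)]
    have hr : ∀ ξ, inner ℝ ξ t * Complex.I =
        -(2 * Real.pi * Complex.I * (inner ℝ (-(2 * Real.pi)⁻¹ • t) ξ : ℝ)) := by
      intro ξ
      rw [real_inner_smul_left, real_inner_comm]
      push_cast
      field_simp
    apply Complex.ext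
    · have := key 1 (-(2 * Real.pi)⁻¹ • t) (by simp)
      rw [← RCLike.re_eq_complex_re, ← integral_re (hI _ (hτ f hf hfc)),
        ← integral_re (hI _ (hσ f hf hfc))]
      simp only [RCLike.re_eq_complex_re, Complex.smul_re, ENNReal.toReal_ofReal (sq_nonneg _), hr]
      simpa using this.symm
    · have := key (-Complex.I) (-(2 * Real.pi)⁻¹ • t) (by simp)
      rw [← RCLike.im_eq_complex_im, ← integral_im (hI _ (hτ f hf hfc)),
        ← integral_im (hI _ (hσ f hf hfc))]
      simp only [RCLike.im_eq_complex_im, Complex.smul_im, ENNReal.toReal_ofReal (sq_nonneg _), hr]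
      simpa using this.symm
  -- Where `f̂ ≠ 0` the density can be divided out. Countably many of these open sets cover the
  -- space.
  have hres : ∀ f : E d → ℂ, Continuous f → HasCompactSupport f →
      τ.restrict {ξ | 𝓕 f ξ ≠ 0} = σ.restrict {ξ | 𝓕 f ξ ≠ 0} := by
    intro f hf hfc
    have hc := continuous_fourier_of_compactSupport hf hfc
    have hU : MeasurableSet {ξ | 𝓕 f ξ ≠ 0} := (isOpen_ne_fun hc continuous_const).measurableSet
    have hm : Measurable fun ξ => ENNReal.ofReal (‖𝓕 f ξ‖ ^ 2) :=
      ENNReal.measurable_ofReal.comp (by fun_prop)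
    have hinv : ∀ ν : Measure (E d), ((ν.withDensity fun ξ => ENNReal.ofReal (‖𝓕 f ξ‖ ^ 2)).restrict
        {ξ | 𝓕 f ξ ≠ 0}).withDensity (fun ξ => (ENNReal.ofReal (‖𝓕 f ξ‖ ^ 2))⁻¹) =
        ν.restrict {ξ | 𝓕 f ξ ≠ 0} := by
      intro ν
      rw [restrict_withDensity hU, withDensity_inv_same hm]
      · filter_upwards [ae_restrict_mem hU] with ξ hξ
        have : 0 < ‖𝓕 f ξ‖ := norm_pos_iff.2 hξ
        exact (ENNReal.ofReal_pos.2 (by positivity)).ne'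
      · exact Eventually.of_forall fun _ => ENNReal.ofReal_ne_top
    rw [← hinv τ, hden f hf hfc, hinv σ]
  choose F hF1 hF2 hF3 using exists_fourier_ne_zero (d := d)
  obtain ⟨s, hs, hcov⟩ := TopologicalSpace.countable_cover_nhds
    (f := fun ξ => {ζ | 𝓕 (F ξ) ζ ≠ 0}) fun ξ => (isOpen_ne_fun
      (continuous_fourier_of_compactSupport (hF1 ξ) (hF2 ξ)) continuous_const).mem_nhds (hF3 ξ)
  exact (Measure.ext_iff_of_biUnion_eq_univ hs hcov).2 fun ξ _ => hres _ (hF1 ξ) (hF2 ξ)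

/-- Near a given point some `|f̂|²` is bounded below by a positive constant, so its integrability
bounds the mass there. -/
theorem isLocallyFiniteMeasure_of_integrable_fourier_sq {σ : Measure (E d)}
    (hσ : ∀ f : E d → ℂ, Continuous f → HasCompactSupport f →
      Integrable (fun ξ => ‖𝓕 f ξ‖ ^ 2) σ) : IsLocallyFiniteMeasure σ := by
  refine ⟨fun ξ => ?_⟩
  obtain ⟨f, hf, hfc, hne⟩ := exists_fourier_ne_zero ξ
  have hc : Continuous fun ξ => ‖𝓕 f ξ‖ ^ 2 :=
    (continuous_fourier_of_compactSupport hf hfc).norm.pow 2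
  have hpos : 0 < ‖𝓕 f ξ‖ ^ 2 := by
    have : 0 < ‖𝓕 f ξ‖ := norm_pos_iff.2 hne
    positivity
  refine ⟨{ζ | ‖𝓕 f ξ‖ ^ 2 / 2 < ‖𝓕 f ζ‖ ^ 2},
    (isOpen_lt continuous_const hc).mem_nhds (half_lt_self hpos), ?_⟩
  exact (hσ f hf hfc).measure_gt_lt_top (half_pos hpos)

end Uniqueness

/-! ### The dual lattice -/

section DualLattice

variable {d₁ d₂ : ℕ} {ι : Type*} [Fintype ι]

/-- The functional `∑ i, m i * b.repr v i`. -/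
noncomputable def dualFunctional (b : Basis ι ℝ (E d₁ × E d₂)) (m : ι → ℤ) :
    E d₁ × E d₂ →L[ℝ] ℝ :=
  (∑ i, (m i : ℝ) • b.coord i).toContinuousLinearMap

/-- The vector of the dual lattice with coordinates `m` in the dual basis. -/
noncomputable def dualVector (b : Basis ι ℝ (E d₁ × E d₂)) (m : ι → ℤ) : E d₁ × E d₂ :=
  ((InnerProductSpace.toDual ℝ (E d₁)).symm
      ((dualFunctional b m).comp (ContinuousLinearMap.inl ℝ (E d₁) (E d₂))),
    (InnerProductSpace.toDual ℝ (E d₂)).symm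
      ((dualFunctional b m).comp (ContinuousLinearMap.inr ℝ (E d₁) (E d₂))))

/-- The product carries the sup norm rather than an inner product, so Riesz representation is
applied in each factor and the two pairings are added. -/
theorem inner_dualVector (b : Basis ι ℝ (E d₁ × E d₂)) (m : ι → ℤ) (v : E d₁ × E d₂) :
    inner ℝ (dualVector b m).1 v.1 + inner ℝ (dualVector b m).2 v.2 = ∑ i, m i * b.repr v i := by
  have h : dualFunctional b m v = ∑ i, m i * b.repr v i := by
    simp [dualFunctional]
  rw [← h]
  simp only [dualVector, InnerProductSpace.toDual_symm_apply, ContinuousLinearMap.comp_apply,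
    ContinuousLinearMap.inl_apply, ContinuousLinearMap.inr_apply, ← map_add]
  simp

variable {Γ : Submodule ℤ (E d₁ × E d₂)}

theorem dualVector_mem (b : Basis ι ℝ (E d₁ × E d₂)) (hb : Submodule.span ℤ (range b) = Γ)
    (m : ι → ℤ) : dualVector b m ∈ dualSet Γ := by
  intro γ hγ
  rw [← hb] at hγ
  have hr := (b.mem_span_iff_repr_mem ℤ γ).1 hγ
  choose z hz using hr
  refine ⟨∑ i, m i * z i, ?_⟩
  rw [inner_dualVector]
  push_cast
  refine Finset.sum_congr rfl fun i _ => ?_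
  rw [← hz i]
  rfl

/-- Pairing with `b j` returns `m j`, and by nondegeneracy these pairings determine the vector. -/
theorem dualVector_bijective (b : Basis ι ℝ (E d₁ × E d₂))
    (hb : Submodule.span ℤ (range b) = Γ) :
    Function.Bijective fun m : ι → ℤ => (⟨dualVector b m, dualVector_mem b hb m⟩ : dualSet Γ) := by
  classical
  have hcoord : ∀ m j, inner ℝ (dualVector b m).1 (b j).1 + inner ℝ (dualVector b m).2 (b j).2 =
      (m j : ℝ) := by
    intro m j
    rw [inner_dualVector]
    simp [Finsupp.single_apply]
  constructor
  · intro m m' h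
    have h' : dualVector b m = dualVector b m' := congrArg Subtype.val h
    ext j
    have := hcoord m j
    rw [h', hcoord m' j] at this
    exact_mod_cast this.symm
  · rintro ⟨y, hy⟩
    choose m hm using fun j => hy (b j) (hb ▸ Submodule.subset_span ⟨j, rfl⟩)
    refine ⟨m, Subtype.ext ?_⟩
    let T : E d₁ × E d₂ → (E d₁ × E d₂ →ₗ[ℝ] ℝ) := fun z =>
      (innerₛₗ ℝ z.1).comp (LinearMap.fst ℝ _ _) + (innerₛₗ ℝ z.2).comp (LinearMap.snd ℝ _ _)
    have hT : T (dualVector b m) = T y := b.ext fun j => (hcoord m j).trans (hm j).symm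
    have hTv : ∀ v : E d₁ × E d₂, inner ℝ (dualVector b m).1 v.1 + inner ℝ (dualVector b m).2 v.2 =
        inner ℝ y.1 v.1 + inner ℝ y.2 v.2 := fun v => LinearMap.congr_fun hT v
    refine Prod.ext (ext_inner_right ℝ fun x => ?_) (ext_inner_right ℝ fun x => ?_)
    · simpa using hTv (x, 0)
    · simpa using hTv (0, x)

end DualLattice

/-! ### The integral of `f ∗ f*` -/

section ConvStar

variable {d : ℕ} {f : E d → ℂ}

/-- This turns the subtracted term `i² Vol` into a point mass at the origin on the Fourier side. -/
theorem integral_convStar (hf : Continuous f) (hfc : HasCompactSupport f) :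
    ∫ x, convStar f x = ((‖𝓕 f 0‖ ^ 2 : ℝ) : ℂ) := by
  let g : E d → ℂ := fun u => starRingEnd ℂ (f (-u))
  have hi := hf.integrable_of_hasCompactSupport (μ := volume) hfc
  have hg : Integrable g := memLp_one_iff_integrable.1 (memLp_one_iff_integrable.2 hi.comp_neg).star
  have h := integral_convolution (L := ContinuousLinearMap.mul ℝ ℂ) (μ := volume) (ν := volume) hi hg
  have h1 : ∀ x, convStar f x = convolution f g (ContinuousLinearMap.mul ℝ ℂ) volume x := by
    intro x
    simp [convolution, convStar, g]
  simp_rw [h1]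
  rw [h]
  have h2 : ∫ u, g u = starRingEnd ℂ (∫ u, f u) := by
    rw [← integral_conj, ← integral_neg_eq_self]
    simp [g]
  have h3 : 𝓕 f 0 = ∫ u, f u := by
    rw [fourier_apply_exp]
    simp
  rw [h2, h3, ContinuousLinearMap.mul_apply', Complex.mul_conj']
  push_cast
  rfl

end ConvStar

instance instIsAddHaarMeasureProd (d₁ d₂ : ℕ) :
    (volume : Measure (E d₁ × E d₂)).IsAddHaarMeasure :=
  inferInstanceAs ((volume : Measure (E d₁)).prod (volume : Measure (E d₂))).IsAddHaarMeasure

/-! ### The summation formula for `f ⊗ χ_W` -/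

section Summation

variable {d₁ d₂ : ℕ} {Γ : Submodule ℤ (E d₁ × E d₂)} [DiscreteTopology Γ] [IsZLattice ℝ Γ]
  {f : E d₁ → ℂ} {W : Set (E d₂)}

/-- The covolume of `Γ`. -/
noncomputable def covol (Γ : Submodule ℤ (E d₁ × E d₂)) [DiscreteTopology Γ] [IsZLattice ℝ Γ] : ℝ :=
  volume.real (fundDomain Γ)

theorem fundDomain_ne_zero : volume (fundDomain Γ) ≠ 0 :=
  ZSpan.measure_fundamentalDomain_ne_zero _

theorem fundDomain_ne_top : volume (fundDomain Γ) ≠ ⊤ :=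
  (ZSpan.fundamentalDomain_isBounded _).measure_lt_top.ne

theorem covol_pos : 0 < covol Γ :=
  ENNReal.toReal_pos fundDomain_ne_zero fundDomain_ne_top

theorem ofReal_covol : ENNReal.ofReal (covol Γ) = volume (fundDomain Γ) :=
  ENNReal.ofReal_toReal fundDomain_ne_top

/-- The weight of `δ_β` in the autocorrelation, up to the covolume. -/
noncomputable def overlap (W : Set (E d₂)) (z : E d₂) : ℝ :=
  volume.real {x | x ∈ W ∧ x - z ∈ W}

theorem hasSum_dualSet (hf : Continuous f) (hfc : HasCompactSupport f) (hW : MeasurableSet W)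
    (hWb : Bornology.IsBounded W) :
    ∃ A : ℝ, (A : ℂ) = ∑' β : Γ, convStar f β.1.1 * overlap W β.1.2 ∧
      HasSum (fun y : dualSet Γ => ‖𝓕 f y.1.1‖ ^ 2 * ‖𝓕 (W.indicator fun _ => (1 : ℂ)) y.1.2‖ ^ 2)
        (covol Γ * A) := by
  let b := (Module.Free.chooseBasis ℤ Γ).ofZLatticeBasis ℝ Γ
  have hb : Submodule.span ℤ (range b) = Γ := Basis.ofZLatticeBasis_span ℝ _ _
  let χ : E d₂ → ℂ := W.indicator fun _ => 1
  -- For this product both sides of the summation formula factor: the correlation at `β` is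
  -- `convStar f` times the window overlap, and the Fourier integral is `f̂(y.1) χ̂_W(y.2)`.
  let φ : E d₁ × E d₂ → ℂ := fun v => f v.1 * χ v.2
  have hχ : Measurable χ := measurable_const.indicator hW
  have hφ : Measurable φ := (hf.measurable.comp measurable_fst).mul (hχ.comp measurable_snd)
  obtain ⟨B, hB⟩ := hfc.exists_bound_of_continuous hf
  have hχ1 : ∀ x, ‖χ x‖ ≤ 1 := fun x => by
    by_cases h : x ∈ W <;> simp [χ, h]
  have hB0 : 0 ≤ B := (norm_nonneg _).trans (hB 0)
  have hφB : ∀ v, ‖φ v‖ ≤ B := fun v => by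
    rw [norm_mul]
    exact (mul_le_mul (hB _) (hχ1 _) (norm_nonneg _) hB0).trans (mul_one B).le
  have hK : Bornology.IsBounded (tsupport f ×ˢ W) := hfc.isCompact.isBounded.prod hWb
  have hφK : ∀ v ∉ tsupport f ×ˢ W, φ v = 0 := by
    intro v hv
    by_cases h1 : v.1 ∈ tsupport f
    · have h2 : v.2 ∉ W := fun h2 => hv ⟨h1, h2⟩
      simp [φ, χ, h2]
    · simp [φ, image_eq_zero_of_notMem_tsupport h1]
  obtain ⟨A, hA, hsum⟩ := hasSum_sq_fourierIntegral (μ := volume) b hb hφ hφB hK hφK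
  refine ⟨A, ?_, ?_⟩
  · rw [hA]
    refine tsum_congr fun β => ?_
    have h1 : ∀ v : E d₁ × E d₂, φ v * starRingEnd ℂ (φ (v - β)) =
        (f v.1 * starRingEnd ℂ (f (v.1 - β.1.1))) *
          ({x | x ∈ W ∧ x - β.1.2 ∈ W}.indicator (fun _ => (1 : ℂ)) v.2) := by
      intro v
      have : {x | x ∈ W ∧ x - β.1.2 ∈ W}.indicator (fun _ => (1 : ℂ)) v.2 =
          χ v.2 * starRingEnd ℂ (χ (v.2 - β.1.2)) := by
        by_cases h1 : v.2 ∈ W <;> by_cases h2 : v.2 - β.1.2 ∈ W <;> simp [χ, h1, h2]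
      rw [this]
      simp only [φ, map_mul, Prod.fst_sub, Prod.snd_sub]
      ring
    simp_rw [h1]
    have hm : MeasurableSet {x | x ∈ W ∧ x - β.1.2 ∈ W} :=
      hW.inter ((measurable_id.sub_const _) hW)
    rw [Measure.volume_eq_prod, integral_prod_mul (fun x => f x * starRingEnd ℂ (f (x - β.1.1)))
      ({x | x ∈ W ∧ x - β.1.2 ∈ W}.indicator fun _ => (1 : ℂ)), integral_indicator_const _ hm]
    simp [convStar, overlap]
  · let e := Equiv.ofBijective _ (dualVector_bijective b hb)
    rw [← e.hasSum_iff]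
    refine HasSum.congr_fun hsum fun m => ?_
    have h2 : ∀ v : E d₁ × E d₂,
        Complex.exp (-(2 * Real.pi * Complex.I * (∑ i, m i * b.repr v i : ℝ))) * φ v =
        (Complex.exp (-(2 * Real.pi * Complex.I * (inner ℝ v.1 (dualVector b m).1 : ℝ))) * f v.1) *
        (Complex.exp (-(2 * Real.pi * Complex.I * (inner ℝ v.2 (dualVector b m).2 : ℝ))) * χ v.2) := by
      intro v
      rw [← inner_dualVector, mul_mul_mul_comm, ← Complex.exp_add, real_inner_comm v.1,
        real_inner_comm v.2]
      congr 2
      push_cast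
      ring
    simp_rw [h2]
    rw [Measure.volume_eq_prod, integral_prod_mul (fun x => Complex.exp (-(2 * Real.pi * Complex.I *
      (inner ℝ x (dualVector b m).1 : ℝ))) * f x) (fun x => Complex.exp (-(2 * Real.pi * Complex.I *
      (inner ℝ x (dualVector b m).2 : ℝ))) * χ x), norm_mul, mul_pow, ← fourier_apply_exp,
      ← fourier_apply_exp]
    rfl

end Summation

theorem measurableSet_unitCube (d : ℕ) : MeasurableSet (unitCube d) := by
  have : unitCube d = ⋂ i, (fun x : E d => x i) ⁻¹' Ico (0 : ℝ) 1 := by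
    ext x
    simp [unitCube]
  rw [this]
  refine MeasurableSet.iInter fun i => measurableSet_Ico.preimage ?_
  exact (EuclideanSpace.proj (𝕜 := ℝ) i).continuous.measurable

theorem volume_unitCube (d : ℕ) : volume (unitCube d) = 1 := by
  have h : unitCube d = (WithLp.ofLp : E d → Fin d → ℝ) ⁻¹' Set.pi univ fun _ => Ico (0 : ℝ) 1 := by
    ext x
    simp [unitCube, Set.mem_pi]
  rw [h, (PiLp.volume_preserving_ofLp (Fin d)).measure_preimage
    (MeasurableSet.univ_pi fun _ => measurableSet_Ico).nullMeasurableSet, volume_pi_pi]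
  simp

/-! ### Intensity and autocorrelation of the process -/

section SecondMoment

variable {d₁ d₂ : ℕ} {Γ : Submodule ℤ (E d₁ × E d₂)} [DiscreteTopology Γ] [IsZLattice ℝ Γ]
  {W : Set (E d₂)}

/-- The indicator function of the window at a translate of a lattice point. -/
noncomputable def windowWeight (W : Set (E d₂)) (v : E d₁ × E d₂) : ℝ≥0∞ :=
  W.indicator (fun _ => 1) v.2

theorem measurable_windowWeight (hW : MeasurableSet W) :
    Measurable (windowWeight (d₁ := d₁) W) :=
  (measurable_const.indicator hW).comp measurable_snd

/-- Injectivity of the projection makes a point determine its lattice vector, so no point is counted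
twice. A sum over all of `Γ` can be unfolded over the fundamental domain. -/
theorem cutAndProject_mk (hΓ : ProjectsInjectively Γ) (v : E d₁ × E d₂) :
    cutAndProject Γ W (QuotientAddGroup.mk' Γ.toAddSubgroup v) =
      Measure.sum fun γ : Γ => windowWeight W ((γ : E d₁ × E d₂) + v) • Measure.dirac ((γ : E d₁ × E d₂) + v).1 := by
  have hmem : ∀ x y, QuotientAddGroup.mk' Γ.toAddSubgroup (x, y) =
      QuotientAddGroup.mk' Γ.toAddSubgroup v ↔ (x, y) - v ∈ Γ := by
    intro x y
    rw [QuotientAddGroup.mk'_apply, QuotientAddGroup.mk'_apply, eq_comm, QuotientAddGroup.eq,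
      neg_add_eq_sub]
    rfl
  let e : {γ : Γ | ((γ : E d₁ × E d₂) + v).2 ∈ W} →
      cutAndProjectSet Γ W (QuotientAddGroup.mk' Γ.toAddSubgroup v) := fun γ =>
    ⟨((γ : E d₁ × E d₂) + v).1, ((γ : E d₁ × E d₂) + v).2, γ.2, by
      rw [hmem]
      change (γ : E d₁ × E d₂) + v - v ∈ Γ
      rw [add_sub_cancel_right]
      exact γ.1.2⟩
  have he : Function.Bijective e := by
    constructor
    · rintro ⟨γ, hγ⟩ ⟨γ', hγ'⟩ h
      have h1 : ((γ : E d₁ × E d₂) + v).1 = ((γ' : E d₁ × E d₂) + v).1 := congrArg Subtype.val h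
      have h2 : (γ : E d₁ × E d₂) = γ' := hΓ γ.2 γ'.2 (by simpa using h1)
      exact Subtype.ext (Subtype.ext h2)
    · rintro ⟨x, y, hy, hxy⟩
      rw [hmem] at hxy
      refine ⟨⟨⟨_, hxy⟩, by simpa using hy⟩, Subtype.ext ?_⟩
      simp [e]
  refine Measure.ext fun A hA => ?_
  rw [cutAndProject, Measure.sum_apply _ hA, Measure.sum_apply _ hA,
    ← (Equiv.ofBijective e he).tsum_eq]
  have : ∀ γ : Γ, (windowWeight W ((γ : E d₁ × E d₂) + v) •
      Measure.dirac ((γ : E d₁ × E d₂) + v).1) A =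
      {γ : Γ | ((γ : E d₁ × E d₂) + v).2 ∈ W}.indicator
        (fun γ : Γ => Measure.dirac ((γ : E d₁ × E d₂) + v).1 A) γ := by
    intro γ
    by_cases h : ((γ : E d₁ × E d₂) + v).2 ∈ W
    · rw [Set.indicator_of_mem (by exact h)]
      rw [Measure.smul_apply, smul_eq_mul, windowWeight, Set.indicator_of_mem h, one_mul]
    · rw [Set.indicator_of_notMem (by exact h)]
      rw [Measure.smul_apply, smul_eq_mul, windowWeight, Set.indicator_of_notMem h, zero_mul]
  simp_rw [this]
  rw [← tsum_subtype]
  rfl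

theorem lintegral_torusMeasure {F : Torus Γ → ℝ≥0∞} (hF : Measurable F) :
    ∫⁻ ω, F ω ∂torusMeasure Γ =
      (volume (fundDomain Γ))⁻¹ * ∫⁻ v in fundDomain Γ, F (QuotientAddGroup.mk' Γ.toAddSubgroup v) := by
  rw [torusMeasure, lintegral_smul_measure, lintegral_map hF]
  · rfl
  · exact measurable_quotient_mk''

theorem lintegral_tsum_lattice {G : E d₁ × E d₂ → ℝ≥0∞} (hG : Measurable G) :
    ∫⁻ v in fundDomain Γ, ∑' γ : Γ, G (γ + v) = ∫⁻ v, G v := by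
  have hD : IsAddFundamentalDomain Γ (fundDomain Γ) volume :=
    ZLattice.isAddFundamentalDomain (Module.Free.chooseBasis ℤ Γ) volume
  rw [hD.lintegral_eq_tsum'' G, lintegral_tsum]
  · rfl
  · exact fun γ => (hG.comp (measurable_const_add _)).aemeasurable

theorem measurable_cutAndProject_apply (hΓ : ProjectsInjectively Γ) (hW : MeasurableSet W)
    {A : Set (E d₁)} (hA : MeasurableSet A) : Measurable fun ω => cutAndProject Γ W ω A := by
  refine measurable_from_quotient.2 ?_
  change Measurable fun v => cutAndProject Γ W (QuotientAddGroup.mk' Γ.toAddSubgroup v) A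
  simp_rw [cutAndProject_mk hΓ, Measure.sum_apply _ hA, Measure.smul_apply,
    Measure.dirac_apply' _ hA, smul_eq_mul]
  refine Measurable.tsum fun γ => ?_
  exact ((measurable_windowWeight hW).comp (measurable_const_add _)).mul
    ((measurable_one.indicator hA).comp (measurable_fst.comp (measurable_const_add _)))

theorem intensity_cutAndProject (hΓ : ProjectsInjectively Γ) (hW : MeasurableSet W) :
    intensity (torusMeasure Γ) (cutAndProject Γ W) = (covol Γ)⁻¹ * volume.real W := by
  have hQ := measurableSet_unitCube d₁
  rw [intensity, lintegral_torusMeasure (measurable_cutAndProject_apply hΓ hW hQ)]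
  simp_rw [cutAndProject_mk hΓ, Measure.sum_apply _ hQ, Measure.smul_apply,
    Measure.dirac_apply' _ hQ, smul_eq_mul]
  rw [lintegral_tsum_lattice (G := fun v => windowWeight W v * (unitCube d₁).indicator 1 v.1)]
  · have : ∀ v : E d₁ × E d₂, windowWeight W v * (unitCube d₁).indicator 1 v.1 =
        (unitCube d₁).indicator 1 v.1 * W.indicator 1 v.2 := fun v => mul_comm _ _
    simp_rw [this]
    rw [Measure.volume_eq_prod, lintegral_prod_mul (measurable_one.indicator hQ).aemeasurable
      (measurable_one.indicator hW).aemeasurable, lintegral_indicator_one hQ,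
      lintegral_indicator_one hW, volume_unitCube, one_mul, ENNReal.toReal_mul, ENNReal.toReal_inv]
    rfl
  · exact (measurable_windowWeight hW).mul ((measurable_one.indicator hQ).comp measurable_fst)

theorem prod_cutAndProject_mk (hΓ : ProjectsInjectively Γ) (v : E d₁ × E d₂) :
    (cutAndProject Γ W (QuotientAddGroup.mk' Γ.toAddSubgroup v)).prod
      (cutAndProject Γ W (QuotientAddGroup.mk' Γ.toAddSubgroup v)) =
    Measure.sum fun γ : Γ × Γ => (windowWeight W ((γ.1 : E d₁ × E d₂) + v) * windowWeight W ((γ.2 : E d₁ × E d₂) + v)) •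
      Measure.dirac (((γ.1 : E d₁ × E d₂) + v).1, ((γ.2 : E d₁ × E d₂) + v).1) := by
  rw [cutAndProject_mk hΓ, Measure.prod_sum]
  congr 1
  ext1 γ
  rw [Measure.prod_smul_left, Measure.prod_smul_right, Measure.dirac_prod_dirac, smul_smul]

theorem measurable_prod_cutAndProject (hΓ : ProjectsInjectively Γ) (hW : MeasurableSet W) :
    Measurable fun ω => (cutAndProject Γ W ω).prod (cutAndProject Γ W ω) := by
  refine measurable_from_quotient.2 ?_
  refine Measure.measurable_of_measurable_coe _ fun A hA => ?_
  change Measurable fun v => ((cutAndProject Γ W (QuotientAddGroup.mk' Γ.toAddSubgroup v)).prod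
      (cutAndProject Γ W (QuotientAddGroup.mk' Γ.toAddSubgroup v))) A
  simp_rw [prod_cutAndProject_mk hΓ, Measure.sum_apply _ hA, Measure.smul_apply,
    Measure.dirac_apply' _ hA, smul_eq_mul]
  refine Measurable.tsum fun γ => ?_
  have h : ∀ γ : Γ, Measurable fun v : E d₁ × E d₂ => windowWeight W ((γ : E d₁ × E d₂) + v) := fun γ =>
    (measurable_windowWeight hW).comp (measurable_const_add _)
  have h' : ∀ γ : Γ, Measurable fun v : E d₁ × E d₂ => ((γ : E d₁ × E d₂) + v).1 := fun γ =>
    measurable_fst.comp (measurable_const_add _)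
  exact ((h _).mul (h _)).mul ((measurable_one.indicator hA).comp ((h' _).prodMk (h' _)))

/-- Pairs of lattice vectors are indexed by their difference `β` and the second vector. The
difference of the points is `β.1.1` alone, so the sum over the second vector unfolds to the whole
space. There the unit cube contributes one and the window its overlap with a translate. -/
theorem autocorrelation_cutAndProject (hΓ : ProjectsInjectively Γ) (hW : MeasurableSet W)
    (hWb : Bornology.IsBounded W) :
    autocorrelation (torusMeasure Γ) (cutAndProject Γ W) =
      Measure.sum fun β : Γ => ENNReal.ofReal ((covol Γ)⁻¹ * overlap W β.1.2) •
        Measure.dirac β.1.1 := by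
  have hQ := measurableSet_unitCube d₁
  have hsub : Measurable fun z : E d₁ × E d₁ => z.1 - z.2 := measurable_fst.sub measurable_snd
  refine Measure.ext fun A hA => ?_
  have hT : MeasurableSet ((fun z : E d₁ × E d₁ => z.1 - z.2) ⁻¹' A ∩ univ ×ˢ unitCube d₁) :=
    (hsub hA).inter (MeasurableSet.univ.prod hQ)
  rw [autocorrelation, Measure.map_apply hsub hA, Measure.restrict_apply (hsub hA), secondMoment,
    Measure.bind_apply hT (measurable_prod_cutAndProject hΓ hW).aemeasurable,
    lintegral_torusMeasure (F := fun ω => ((cutAndProject Γ W ω).prod (cutAndProject Γ W ω))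
      ((fun z : E d₁ × E d₁ => z.1 - z.2) ⁻¹' A ∩ univ ×ˢ unitCube d₁)) ((Measure.measurable_coe hT).comp (measurable_prod_cutAndProject hΓ hW))]
  let G : Γ → E d₁ × E d₂ → ℝ≥0∞ := fun β v =>
    A.indicator 1 β.1.1 * ((unitCube d₁).indicator 1 v.1 *
      {x | x + β.1.2 ∈ W ∧ x ∈ W}.indicator 1 v.2)
  have hWβ : ∀ β : Γ, MeasurableSet {x | x + β.1.2 ∈ W ∧ x ∈ W} := fun β =>
    ((measurable_add_const _) hW).inter hW
  have hG : ∀ β, Measurable (G β) := fun β =>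
    (((measurable_one.indicator hQ).comp measurable_fst).mul
      ((measurable_one.indicator (hWβ β)).comp measurable_snd)).const_mul _
  have hpt : ∀ v : E d₁ × E d₂, ((cutAndProject Γ W (QuotientAddGroup.mk' Γ.toAddSubgroup v)).prod
      (cutAndProject Γ W (QuotientAddGroup.mk' Γ.toAddSubgroup v)))
      ((fun z : E d₁ × E d₁ => z.1 - z.2) ⁻¹' A ∩ univ ×ˢ unitCube d₁) =
      ∑' β : Γ, ∑' γ : Γ, G β (γ + v) := by
    intro v
    rw [prod_cutAndProject_mk hΓ, Measure.sum_apply _ hT]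
    let e : Γ × Γ ≃ Γ × Γ :=
      ⟨fun p => (p.1 + p.2, p.2), fun p => (p.1 - p.2, p.2), fun p => by simp, fun p => by simp⟩
    rw [← e.tsum_eq, ENNReal.tsum_prod']
    refine tsum_congr fun β => tsum_congr fun γ => ?_
    rw [Measure.smul_apply, Measure.dirac_apply' _ hT, smul_eq_mul]
    have e1 : (((β + γ : Γ) : E d₁ × E d₂) + v).1 - ((γ : E d₁ × E d₂) + v).1 = β.1.1 := by
      simp
    have e2 : (((β + γ : Γ) : E d₁ × E d₂) + v).2 = ((γ : E d₁ × E d₂) + v).2 + β.1.2 := by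
      simp only [Submodule.coe_add, Prod.snd_add]
      abel
    change windowWeight W (((β + γ : Γ) : E d₁ × E d₂) + v) * windowWeight W ((γ : E d₁ × E d₂) + v) *
      ((fun z : E d₁ × E d₁ => z.1 - z.2) ⁻¹' A ∩ univ ×ˢ unitCube d₁).indicator 1
        ((((β + γ : Γ) : E d₁ × E d₂) + v).1, ((γ : E d₁ × E d₂) + v).1) = _
    simp only [windowWeight, e2, G]
    by_cases h1 : β.1.1 ∈ A <;> by_cases h2 : ((γ : E d₁ × E d₂) + v).1 ∈ unitCube d₁ <;>
      by_cases h3 : ((γ : E d₁ × E d₂) + v).2 + β.1.2 ∈ W <;>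
      by_cases h4 : ((γ : E d₁ × E d₂) + v).2 ∈ W <;>
      simp only [Set.indicator, Set.mem_inter_iff, Set.mem_preimage, Set.mem_prod, Set.mem_univ,
        Set.mem_ofPred_eq, e1, h1, h2, h3, h4] <;> simp
  simp only [hpt]
  have hGm : ∀ β : Γ, Measurable fun v => ∑' γ : Γ, G β ((γ : E d₁ × E d₂) + v) := fun β =>
    Measurable.tsum fun γ => (hG β).comp (measurable_const_add _)
  rw [lintegral_tsum fun β => (hGm β).aemeasurable, Measure.sum_apply _ hA, ← ENNReal.tsum_mul_left]
  refine tsum_congr fun β => ?_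
  have hvol : ∫⁻ v, G β v = A.indicator 1 β.1.1 * ENNReal.ofReal (overlap W β.1.2) := by
    have hm : Measurable fun v : E d₁ × E d₂ => (unitCube d₁).indicator (1 : E d₁ → ℝ≥0∞) v.1 *
        {x | x + β.1.2 ∈ W ∧ x ∈ W}.indicator (1 : E d₂ → ℝ≥0∞) v.2 :=
      ((measurable_one.indicator hQ).comp measurable_fst).mul
        ((measurable_one.indicator (hWβ β)).comp measurable_snd)
    rw [lintegral_const_mul _ hm, Measure.volume_eq_prod,
      lintegral_prod_mul (f := (unitCube d₁).indicator 1)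
      (g := {x | x + β.1.2 ∈ W ∧ x ∈ W}.indicator 1) (measurable_one.indicator hQ).aemeasurable
      (measurable_one.indicator (hWβ β)).aemeasurable, lintegral_indicator_one hQ,
      lintegral_indicator_one (hWβ β), volume_unitCube, one_mul]
    congr 1
    have hpre : {x | x + β.1.2 ∈ W ∧ x ∈ W} = (fun x => x + β.1.2) ⁻¹' {x | x ∈ W ∧ x - β.1.2 ∈ W} := by
      ext x
      simp
    rw [hpre, measure_preimage_add_right, overlap, Measure.real, ENNReal.ofReal_toReal]
    exact (hWb.subset fun x hx => hx.1).measure_lt_top.ne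
  rw [lintegral_tsum_lattice (hG β), hvol, Measure.smul_apply, Measure.dirac_apply' _ hA, smul_eq_mul,
    ENNReal.ofReal_mul (inv_nonneg.2 covol_pos.le), ENNReal.ofReal_inv_of_pos covol_pos, ofReal_covol]
  ring

end SecondMoment

/-! ### Dense projection by duality -/

section Density

variable {d₁ d₂ : ℕ} {Γ : Submodule ℤ (E d₁ × E d₂)} [DiscreteTopology Γ] [IsZLattice ℝ Γ]

/-- A lattice projects densely to the second factor if the first components of the nonzero vectors
of its dual lattice do not vanish. -/
theorem projectsDensely_of_dualSet (hΓ : ∀ y ∈ dualSet Γ, y ≠ 0 → y.1 ≠ 0) :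
    ProjectsDensely Γ := by
  rw [ProjectsDensely, Metric.dense_iff]
  intro h r hr
  -- An ergodicity argument: `U` is open and invariant under `Γ` and under translations of the first
  -- factor. All Fourier coefficients of its indicator function except the zeroth vanish, so `U` has
  -- full measure and meets every nonempty open set.
  let U : Set (E d₁ × E d₂) := {v | ∃ γ : Γ, ‖v.2 - γ.1.2‖ < r / 2}
  have hUo : IsOpen U := by
    have : U = ⋃ γ : Γ, {v : E d₁ × E d₂ | ‖v.2 - γ.1.2‖ < r / 2} := by
      ext v
      simp [U]
    rw [this]
    exact isOpen_iUnion fun γ => isOpen_lt (by fun_prop) continuous_const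
  have hU0 : (0 : E d₁ × E d₂) ∈ U := ⟨0, by simpa using hr⟩
  have hUΓ : ∀ (γ : Γ) v, (γ : E d₁ × E d₂) + v ∈ U ↔ v ∈ U := by
    intro γ v
    constructor
    · rintro ⟨β, hβ⟩
      refine ⟨β - γ, ?_⟩
      convert hβ using 2
      simp only [Submodule.coe_sub, Prod.snd_sub, Prod.snd_add]
      abel
    · rintro ⟨β, hβ⟩
      refine ⟨β + γ, ?_⟩
      convert hβ using 2
      simp only [Submodule.coe_add, Prod.snd_add]
      abel
  have hUg : ∀ (x : E d₁) v, (x, (0 : E d₂)) + v ∈ U ↔ v ∈ U := by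
    intro x v
    simp [U]
  let b := (Module.Free.chooseBasis ℤ Γ).ofZLatticeBasis ℝ Γ
  have hb : Submodule.span ℤ (range b) = Γ := Basis.ofZLatticeBasis_span ℝ _ _
  set D := fundDomain Γ
  have hD : IsAddFundamentalDomain Γ D (volume : Measure (E d₁ × E d₂)) :=
    ZLattice.isAddFundamentalDomain (Module.Free.chooseBasis ℤ Γ) volume
  let F : E d₁ × E d₂ → ℂ := U.indicator fun _ => 1
  have hF1 : ∀ v, ‖F v‖ ≤ 1 := fun v => by
    by_cases h : v ∈ U <;> simp [F, h]
  have hFm : Measurable F := measurable_const.indicator hUo.measurableSet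
  have : IsFiniteMeasure ((volume : Measure (E d₁ × E d₂)).restrict D) :=
    ⟨by rw [Measure.restrict_apply_univ]; exact fundDomain_ne_top.lt_top⟩
  have hFL : MemLp F 2 (volume.restrict D) :=
    MemLp.of_bound hFm.aestronglyMeasurable 1 (Eventually.of_forall hF1)
  have hFadd : ∀ u v, (u + v ∈ U ↔ v ∈ U) → F (u + v) = F v := by
    intro u v huv
    by_cases hv : v ∈ U
    · change U.indicator _ _ = U.indicator _ _
      rw [Set.indicator_of_mem hv, Set.indicator_of_mem (huv.2 hv)]
    · change U.indicator _ _ = U.indicator _ _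
      rw [Set.indicator_of_notMem hv, Set.indicator_of_notMem (mt huv.1 hv)]
  have hP : HasSum (fun m : Module.Free.ChooseBasisIndex ℤ Γ → ℤ =>
      ‖∫ v in D, Complex.exp (-(2 * Real.pi * Complex.I *
        (∑ i, m i * b.repr v i : ℝ))) * F v‖ ^ 2)
      (volume.real D * ∫ v in D, ‖F v‖ ^ 2) :=
    hasSum_sq_fourierCoeff_fundamentalDomain b volume hFL
  have hvanish : ∀ m : Module.Free.ChooseBasisIndex ℤ Γ → ℤ, m ≠ 0 → ∫ v in D, Complex.exp (-(2 * Real.pi * Complex.I *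
      (∑ i, m i * b.repr v i : ℝ))) * F v = 0 := by
    intro m hm
    set y := dualVector b m
    have hyd : y ∈ dualSet Γ := dualVector_mem b hb m
    have hy0 : y ≠ 0 := by
      intro h0
      refine hm ((dualVector_bijective b hb).1 (Subtype.ext ?_))
      have hz : dualVector b (0 : Module.Free.ChooseBasisIndex ℤ Γ → ℤ) = 0 := by
        have : dualFunctional b (0 : Module.Free.ChooseBasisIndex ℤ Γ → ℤ) = 0 := by
          ext <;> simp [dualFunctional]
        simp [dualVector, this]
      exact h0.trans hz.symm
    have hy1 : y.1 ≠ 0 := hΓ y hyd hy0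
    let e : E d₁ × E d₂ → ℂ := fun v => Complex.exp (-(2 * Real.pi * Complex.I *
      (inner ℝ y.1 v.1 + inner ℝ y.2 v.2 : ℝ)))
    have hee : ∀ v, Complex.exp (-(2 * Real.pi * Complex.I * (∑ i, m i * b.repr v i : ℝ))) = e v := by
      intro v
      rw [← inner_dualVector]
    have he_add : ∀ v w, e (v + w) = e v * e w := by
      intro v w
      simp only [e]
      rw [← Complex.exp_add]
      congr 1
      simp only [Prod.fst_add, Prod.snd_add, inner_add_right]
      push_cast
      ring
    have heΓ : ∀ γ : Γ, e γ = 1 := by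
      intro γ
      obtain ⟨k, hk⟩ := hyd γ γ.2
      simp only [e, hk]
      rw [Complex.exp_eq_one_iff]
      refine ⟨-k, ?_⟩
      push_cast
      ring
    -- A translation of the first factor that pairs with `y` to `1/2`. It negates the character and
    -- fixes `F`, so the coefficient equals its own negative.
    let w : E d₁ × E d₂ := ((2 * ‖y.1‖ ^ 2)⁻¹ • y.1, 0)
    have hw : e w = -1 := by
      have : inner ℝ y.1 w.1 + inner ℝ y.2 w.2 = (1 / 2 : ℝ) := by
        have : ‖y.1‖ ≠ 0 := norm_ne_zero_iff.2 hy1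
        simp only [w, inner_smul_right, real_inner_self_eq_norm_sq, inner_zero_right, add_zero]
        field_simp
      simp only [e, this]
      rw [show -(2 * (Real.pi : ℂ) * Complex.I * ((1 / 2 : ℝ) : ℂ)) = -(Real.pi * Complex.I) by
        push_cast
        ring, Complex.exp_neg, Complex.exp_pi_mul_I]
      norm_num
    simp_rw [hee]
    let G : E d₁ × E d₂ → ℂ := fun v => e v * F v
    have hGΓ : ∀ (γ : Γ) v, G (γ +ᵥ v) = G v := by
      intro γ v
      change e (γ + v) * F (γ + v) = e v * F v
      rw [he_add, heΓ, one_mul, hFadd _ _ (hUΓ γ v)]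
    have hGw : ∀ v, G (w + v) = -G v := by
      intro v
      simp only [G]
      rw [he_add, hw, neg_one_mul, neg_mul, hFadd _ _ (hUg _ v)]
    have h1 : ∫ v in D, G (w + v) = ∫ v in D, G v := by
      have hmp : MeasurePreserving (fun v : E d₁ × E d₂ => w + v) volume volume :=
        measurePreserving_add_left volume w
      have hemb : MeasurableEmbedding fun v : E d₁ × E d₂ => w + v :=
        (Homeomorph.addLeft w).measurableEmbedding
      rw [← hmp.setIntegral_image_emb hemb]
      have hD' : IsAddFundamentalDomain Γ ((fun v => w + v) '' D)
          (volume : Measure (E d₁ × E d₂)) := by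
        have := hD.vadd_of_comm w
        exact this
      exact hD'.setIntegral_eq hD hGΓ
    simp_rw [hGw] at h1
    rw [integral_neg] at h1
    exact self_eq_neg.1 h1.symm
  -- Parseval reduces to `vol D · vol (D ∩ U) = vol (D ∩ U)²`. Since `U` is open, nonempty and
  -- invariant, `vol (D ∩ U)` is positive and can be cancelled.
  have hone := hP.unique (hasSum_single 0 fun m hm => by rw [hvanish m hm]; simp)
  have hmu : ∫ v in D, ‖F v‖ ^ 2 = volume.real (D ∩ U) := by
    have : ∀ v, ‖F v‖ ^ 2 = U.indicator (fun _ => (1 : ℝ)) v := fun v => by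
      by_cases h : v ∈ U <;> simp [F, h]
    simp_rw [this]
    rw [setIntegral_indicator hUo.measurableSet]
    simp
  have hc0 : ∫ v in D, Complex.exp (-(2 * Real.pi * Complex.I *
      (∑ i, ((0 : Module.Free.ChooseBasisIndex ℤ Γ → ℤ) i : ℝ) * b.repr v i : ℝ))) * F v =
      (volume.real (D ∩ U) : ℂ) := by
    simp only [Pi.zero_apply, Int.cast_zero, zero_mul, Finset.sum_const_zero, Complex.ofReal_zero,
      mul_zero, neg_zero, Complex.exp_zero, one_mul, F]
    rw [setIntegral_indicator hUo.measurableSet]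
    simp
  rw [hc0, hmu, Complex.norm_real, Real.norm_of_nonneg measureReal_nonneg] at hone
  have hpos : volume (D ∩ U) ≠ 0 := by
    intro h0
    refine (hUo.measure_pos volume ⟨0, hU0⟩).ne' (hD.measure_zero_of_invariant U ?_ ?_)
    · intro γ
      ext v
      rw [Set.mem_vadd_set_iff_neg_vadd_mem]
      exact hUΓ (-γ) v
    · rwa [Set.inter_comm]
  have hfin : volume (D ∩ U) ≠ ⊤ := ne_top_of_le_ne_top fundDomain_ne_top (measure_mono inter_subset_left)
  have hfull : volume.real D = volume.real (D ∩ U) := by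
    have : 0 < volume.real (D ∩ U) := ENNReal.toReal_pos hpos hfin
    have h2 : volume.real D * volume.real (D ∩ U) = volume.real (D ∩ U) ^ 2 := hone
    nlinarith [mul_right_cancel₀ this.ne' (h2.trans (sq _))]
  have hcompl : volume Uᶜ = 0 := by
    refine hD.measure_zero_of_invariant Uᶜ ?_ ?_
    · intro γ
      ext v
      rw [Set.mem_vadd_set_iff_neg_vadd_mem]
      exact not_congr (hUΓ (-γ) v)
    · have h3 : Uᶜ ∩ D = D \ U := by
        ext v
        simp [and_comm]
      have h4 := measureReal_inter_add_sdiff (μ := (volume : Measure (E d₁ × E d₂))) (s := D)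
        (t := U) hUo.measurableSet fundDomain_ne_top
      have h5 : volume.real (D \ U) = 0 := by linarith
      rw [h3]
      exact (measureReal_eq_zero_iff (ne_top_of_le_ne_top fundDomain_ne_top
        (measure_mono sdiff_subset))).1 h5
  have hne : ((univ ×ˢ Metric.ball h (r / 2)) ∩ U).Nonempty := by
    by_contra hemp
    rw [Set.not_nonempty_iff_eq_empty] at hemp
    have hsub : (univ ×ˢ Metric.ball h (r / 2) : Set (E d₁ × E d₂)) ⊆ Uᶜ := fun v hv hvU =>
      (Set.eq_empty_iff_forall_notMem.1 hemp v) ⟨hv, hvU⟩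
    exact ((isOpen_univ.prod Metric.isOpen_ball).measure_pos volume
      ⟨((0 : E d₁), h), trivial, Metric.mem_ball_self (by linarith)⟩).ne' (measure_mono_null hsub hcompl)
  obtain ⟨v, ⟨-, hv⟩, γ, hγ⟩ := hne
  refine ⟨γ.1.2, ?_, γ, γ.2, rfl⟩
  rw [Metric.mem_ball, dist_eq_norm] at hv ⊢
  calc ‖γ.1.2 - h‖ = ‖(v.2 - h) - (v.2 - γ.1.2)‖ := by congr 1; abel
    _ ≤ _ := norm_sub_le _ _
    _ < r := by linarith

end Density

/-! ### The diffraction measure and its mass near the origin -/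

section Diffraction

variable {d₁ d₂ : ℕ} {Γ : Submodule ℤ (E d₁ × E d₂)} [DiscreteTopology Γ] [IsZLattice ℝ Γ]
  {W : Set (E d₂)}

/-- The Fourier transform of the indicator function of `W`. -/
noncomputable def windowFourier (W : Set (E d₂)) (ζ : E d₂) : ℂ :=
  𝓕 (W.indicator fun _ => (1 : ℂ)) ζ

/-- The intensity of the diffraction at the point `y` of the dual lattice. -/
noncomputable def diffractionWeight (Γ : Submodule ℤ (E d₁ × E d₂)) [DiscreteTopology Γ]
    [IsZLattice ℝ Γ] (W : Set (E d₂)) (y : E d₁ × E d₂) : ℝ :=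
  (covol Γ)⁻¹ ^ 2 * ‖windowFourier W y.2‖ ^ 2

/-- The centered diffraction of the cut-and-project process: a sum of point masses at the first
components of the nonzero vectors of the dual lattice. -/
noncomputable def diffraction (Γ : Submodule ℤ (E d₁ × E d₂)) [DiscreteTopology Γ]
    [IsZLattice ℝ Γ] (W : Set (E d₂)) : Measure (E d₁) :=
  Measure.sum fun y : {y : dualSet Γ // y.1 ≠ 0} =>
    ENNReal.ofReal (diffractionWeight Γ W y.1.1) • Measure.dirac y.1.1.1

instance instCountableDualSet : Countable (dualSet Γ) :=
  (dualVector_bijective ((Module.Free.chooseBasis ℤ Γ).ofZLatticeBasis ℝ Γ)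
    (Basis.ofZLatticeBasis_span ℝ _ _)).2.countable

theorem diffractionWeight_nonneg (y : E d₁ × E d₂) : 0 ≤ diffractionWeight Γ W y := by
  rw [diffractionWeight]
  positivity

theorem norm_windowFourier_zero (hW : MeasurableSet W) :
    ‖windowFourier W 0‖ = volume.real W := by
  rw [windowFourier, fourier_apply_exp]
  simp only [inner_zero_right, Complex.ofReal_zero, mul_zero, neg_zero, Complex.exp_zero, one_mul]
  rw [integral_indicator_const _ hW]
  simp

/-- This is the summation formula divided by `covol²`. The deleted term `y = 0` is `covol⁻² |f̂(0)|²
(vol W)²`, which equals `i² ∫ f ∗ f*`. -/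
theorem isCenteredDiffraction_diffraction (hΓ : ProjectsInjectively Γ) (hW : MeasurableSet W)
    (hWb : Bornology.IsBounded W) :
    IsCenteredDiffraction (torusMeasure Γ) (cutAndProject Γ W) (diffraction Γ W) := by
  have key : ∀ f : E d₁ → ℂ, Continuous f → HasCompactSupport f →
      Integrable (fun ξ => ‖𝓕 f ξ‖ ^ 2) (diffraction Γ W) ∧
        ((∫ ξ, ‖𝓕 f ξ‖ ^ 2 ∂diffraction Γ W : ℝ) : ℂ) =
          centeredAutocorrelation (torusMeasure Γ) (cutAndProject Γ W) (convStar f) := by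
    intro f hf hfc
    obtain ⟨A, hA, hsum⟩ := hasSum_dualSet (Γ := Γ) hf hfc hW hWb
    have h0mem : (0 : E d₁ × E d₂) ∈ dualSet Γ := fun γ _ => ⟨0, by simp⟩
    let y₀ : dualSet Γ := ⟨0, h0mem⟩
    have hs1 := (hasSum_ite_sub_hasSum hsum y₀).mul_left ((covol Γ)⁻¹ ^ 2)
    have hs2 : HasSum (fun y : {y : dualSet Γ // y.1 ≠ 0} =>
        diffractionWeight Γ W y.1.1 * ‖𝓕 f y.1.1.1‖ ^ 2)
        ((covol Γ)⁻¹ ^ 2 * (covol Γ * A - ‖𝓕 f 0‖ ^ 2 * volume.real W ^ 2)) := by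
      refine (hasSum_subtype_iff_indicator (s := {y : dualSet Γ | y.1 ≠ 0})
        (f := fun y : dualSet Γ => diffractionWeight Γ W y.1 * ‖𝓕 f y.1.1‖ ^ 2)).2 ?_
      have h0 : ‖𝓕 (W.indicator fun _ => (1 : ℂ)) y₀.1.2‖ = volume.real W :=
        norm_windowFourier_zero hW
      rw [h0] at hs1
      refine HasSum.congr_fun hs1 fun y => ?_
      by_cases hy : y = y₀
      · subst hy
        simp [y₀]
      · have hy' : y ∈ {y : dualSet Γ | y.1 ≠ 0} := fun h => hy (Subtype.ext h)
        rw [Set.indicator_of_mem hy', if_neg hy, diffractionWeight, windowFourier]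
        ring
    constructor
    · refine integrable_sum_dirac (fun _ => ENNReal.ofReal_ne_top) ?_
      simpa [ENNReal.toReal_ofReal (diffractionWeight_nonneg _)] using hs2.summable
    · have hL : ∫ ξ, ‖𝓕 f ξ‖ ^ 2 ∂diffraction Γ W =
          (covol Γ)⁻¹ ^ 2 * (covol Γ * A - ‖𝓕 f 0‖ ^ 2 * volume.real W ^ 2) := by
        rw [diffraction, integral_sum_dirac fun _ => ENNReal.ofReal_ne_top, ← hs2.tsum_eq]
        simp [ENNReal.toReal_ofReal (diffractionWeight_nonneg _)]
      have hR : ∫ x, convStar f x ∂autocorrelation (torusMeasure Γ) (cutAndProject Γ W) =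
          (((covol Γ)⁻¹ * A : ℝ) : ℂ) := by
        rw [autocorrelation_cutAndProject hΓ hW hWb, integral_sum_dirac fun _ => ENNReal.ofReal_ne_top]
        push_cast
        rw [hA, ← tsum_mul_left]
        refine tsum_congr fun β => ?_
        rw [ENNReal.toReal_ofReal (by
            have := (covol_pos (Γ := Γ)).le
            have : 0 ≤ overlap W β.1.2 := measureReal_nonneg
            positivity),
          Complex.real_smul]
        push_cast
        ring
      have hc : (covol Γ : ℂ) ≠ 0 := by exact_mod_cast covol_pos.ne'
      rw [centeredAutocorrelation, hL, hR, intensity_cutAndProject hΓ hW, integral_convStar hf hfc]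
      push_cast
      field_simp
  exact ⟨isLocallyFiniteMeasure_of_integrable_fourier_sq fun f hf hfc => (key f hf hfc).1, key⟩

theorem isCenteredDiffraction_unique {Ω : Type*} [MeasurableSpace Ω] {P : Measure Ω} {d : ℕ}
    {p : Ω → Measure (E d)} {σ τ : Measure (E d)} (hσ : IsCenteredDiffraction P p σ)
    (hτ : IsCenteredDiffraction P p τ) : τ = σ := by
  refine eq_of_integral_fourier_sq_eq (fun f hf hfc => (hσ.2 f hf hfc).1)
    (fun f hf hfc => (hτ.2 f hf hfc).1) fun f hf hfc => ?_
  exact_mod_cast (hσ.2 f hf hfc).2.trans (hτ.2 f hf hfc).2.symm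

theorem sub_mem_dualSet {y z : E d₁ × E d₂} (hy : y ∈ dualSet Γ) (hz : z ∈ dualSet Γ) :
    y - z ∈ dualSet Γ := by
  intro γ hγ
  obtain ⟨k, hk⟩ := hy γ hγ
  obtain ⟨l, hl⟩ := hz γ hγ
  refine ⟨k - l, ?_⟩
  push_cast
  rw [← hk, ← hl, Prod.fst_sub, Prod.snd_sub, inner_sub_left, inner_sub_left]
  ring

/-- The diffraction of small balls, for a lattice whose dual is badly approximable. -/
theorem diffraction_closedBall_le (hΓ : ProjectsInjectively Γ) (hW : MeasurableSet W)
    (hWb : Bornology.IsBounded W) {ϑ : ℝ} (hϑ : 0 < ϑ) (hWϑ : FourierSmooth W ϑ)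
    {κ c : ℝ} (hκ : 0 < κ) (hc : 0 < c)
    (hdual : ∀ y ∈ dualSet Γ, y ≠ 0 → c * (1 + ‖y.1‖ + ‖y.2‖) ^ (-κ) ≤ ‖y.1‖) :
    ∃ C : ℝ, 0 < C ∧ ∀ ε : ℝ, 0 < ε → ε ≤ 1 →
      (diffraction Γ W).real (Metric.closedBall 0 ε) ≤ C * ε ^ ((d₂ + ϑ) / κ) := by
  have : IsLocallyFiniteMeasure (diffraction Γ W) :=
    (isCenteredDiffraction_diffraction hΓ hW hWb).1
  obtain ⟨B, hB⟩ := hWϑ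
  let s : ℝ := d₂ + ϑ
  have hs : (finrank ℝ (E d₂) : ℝ) < s := by
    rw [finrank_euclideanSpace_fin]
    exact lt_add_of_pos_right _ hϑ
  have hs0 : 0 < s := (Nat.cast_nonneg _).trans_lt hs
  obtain ⟨K, hK, hKsum⟩ := exists_tsum_separated_le (V := E d₂) hs
  -- Chosen so that a nonzero dual vector `z` with `‖z.1‖ ≤ 2ε` has `1 + ‖z.2‖ ≥ a ε^(-1/κ)`. The
  -- `2ε` allows for differences of two vectors of the strip; the `3` comes from `1 + ‖z.1‖ + ‖z.2‖
  -- ≤ 3 (1 + ‖z.2‖)`, as `ε ≤ 1`.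
  let a : ℝ := (c * 3 ^ (-κ) / 2) ^ (1 / κ)
  have ha : 0 < a := by positivity
  let M : ℝ := (covol Γ)⁻¹ ^ 2 * B ^ 2
  let S : ℝ≥0∞ := diffraction Γ W (Metric.closedBall 0 1)
  have hS : S ≠ ⊤ := (isCompact_closedBall _ _).measure_lt_top.ne
  have hM : ∀ ζ : E d₂, (covol Γ)⁻¹ ^ 2 * ‖windowFourier W ζ‖ ^ 2 ≤ M * (1 + ‖ζ‖) ^ (-s) := by
    intro ζ
    have h1 : ((1 + ‖ζ‖) ^ (-(s / 2))) ^ 2 = (1 + ‖ζ‖) ^ (-s) := by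
      rw [← Real.rpow_mul_natCast (by positivity)]
      congr 1
      push_cast
      ring
    calc _ ≤ (covol Γ)⁻¹ ^ 2 * (B * (1 + ‖ζ‖) ^ (-(s / 2))) ^ 2 := by
          gcongr
          exact hB ζ
      _ = _ := by
        rw [mul_pow, h1]
        ring
  have hbound : ∀ ε : ℝ, 0 < ε → ε ≤ 1 → diffraction Γ W (Metric.closedBall 0 ε) ≤
      (ENNReal.ofReal M * K + S) * ENNReal.ofReal ((a * ε ^ (-(1 / κ)) / 2) ^ (-s)) := by
    intro ε hε hε1
    set r : ℝ := a * ε ^ (-(1 / κ))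
    have hr0 : 0 < r := by positivity
    -- For `r < 2` the factor `(r/2)^(-s)` is at least one and the mass `S` of the unit ball
    -- suffices. For `r ≥ 2` the bound `‖z.2‖ ≥ r - 1` improves to `‖z.2‖ ≥ r/2`.
    rcases lt_or_ge r 2 with hr2 | hr2
    · have h1 : 1 ≤ ENNReal.ofReal ((r / 2) ^ (-s)) := by
        rw [← ENNReal.ofReal_one]
        exact ENNReal.ofReal_le_ofReal (Real.one_le_rpow_of_pos_of_le_one_of_nonpos (by positivity)
          (by linarith) (by linarith))
      calc _ ≤ S := measure_mono (Metric.closedBall_subset_closedBall hε1)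
        _ ≤ ENNReal.ofReal M * K + S := le_add_self
        _ = (ENNReal.ofReal M * K + S) * 1 := (mul_one _).symm
        _ ≤ _ := by gcongr
    have hsep : ∀ z ∈ dualSet Γ, z ≠ 0 → ‖z.1‖ ≤ 2 * ε → r ≤ 1 + ‖z.2‖ := by
      intro z hz hz0 hzε
      have h1 := hdual z hz hz0
      have h2 : (3 * (1 + ‖z.2‖)) ^ (-κ) ≤ (1 + ‖z.1‖ + ‖z.2‖) ^ (-κ) := by
        refine Real.rpow_le_rpow_of_nonpos (by positivity) ?_ (by linarith)
        linarith [norm_nonneg z.2]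
      have h3 : c * (3 ^ (-κ) * (1 + ‖z.2‖) ^ (-κ)) ≤ 2 * ε := by
        rw [← Real.mul_rpow (by norm_num) (by positivity)]
        exact ((mul_le_mul_of_nonneg_left h2 hc.le).trans h1).trans hzε
      have h4 : c * 3 ^ (-κ) / 2 * ε⁻¹ ≤ (1 + ‖z.2‖) ^ κ := by
        rw [Real.rpow_neg (by positivity : 0 ≤ 1 + ‖z.2‖)] at h3
        have hp : 0 < (1 + ‖z.2‖) ^ κ := by positivity
        rw [← mul_assoc, ← div_eq_mul_inv, div_le_iff₀ hp] at h3
        rw [← div_eq_mul_inv, div_le_iff₀ hε]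
        linarith
      have h5 := Real.rpow_le_rpow (z := 1 / κ) (by positivity) h4 (by positivity)
      rw [← Real.rpow_mul (by positivity), mul_one_div_cancel hκ.ne', Real.rpow_one,
        Real.mul_rpow (by positivity) (by positivity), Real.inv_rpow hε.le,
        ← Real.rpow_neg hε.le] at h5
      exact h5
    let T : Set {y : dualSet Γ // y.1 ≠ 0} := {y | ‖y.1.1.1‖ ≤ ε}
    -- Rescaling by `r` makes the second components half-separated for every `ε`, so the single
    -- constant `K` applies.
    let u : T → E d₂ := fun y => r⁻¹ • y.1.1.1.2
    have hu : ∀ i j : T, i ≠ j → 1 / 2 ≤ ‖u i - u j‖ := by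
      intro i j hij
      have hz := sub_mem_dualSet i.1.1.2 j.1.1.2
      have hz0 : i.1.1.1 - j.1.1.1 ≠ 0 := fun h =>
        hij (Subtype.ext (Subtype.ext (Subtype.ext (sub_eq_zero.1 h))))
      have h1 := hsep _ hz hz0 (by
        have h2 := norm_sub_le i.1.1.1.1 j.1.1.1.1
        have h3 : ‖i.1.1.1.1‖ ≤ ε := i.2
        have h4 : ‖j.1.1.1.1‖ ≤ ε := j.2
        rw [Prod.fst_sub]
        linarith)
      rw [Prod.snd_sub] at h1
      simp only [u]
      rw [← smul_sub, norm_smul, norm_inv, Real.norm_of_nonneg hr0.le, ← div_eq_inv_mul,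
        le_div_iff₀ hr0]
      linarith
    -- Averaging `r ≤ 1 + ‖y.2‖` and `r ‖u y‖ = ‖y.2‖` gives `(r/2)(1 + ‖u y‖) ≤ 1 + ‖y.2‖`, which
    -- extracts the factor `(r/2)^(-s)`.
    have hterm : ∀ y : T, ENNReal.ofReal (diffractionWeight Γ W y.1.1.1) ≤
        ENNReal.ofReal M * ENNReal.ofReal ((r / 2) ^ (-s)) *
          ENNReal.ofReal ((1 + ‖u y‖) ^ (-s)) := by
      intro y
      have hM0 : 0 ≤ M := by positivity
      rw [← ENNReal.ofReal_mul hM0, ← ENNReal.ofReal_mul (by positivity)]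
      refine ENNReal.ofReal_le_ofReal ((hM _).trans ?_)
      rw [mul_assoc M, ← Real.mul_rpow (by positivity) (by positivity)]
      refine mul_le_mul_of_nonneg_left (Real.rpow_le_rpow_of_nonpos (by positivity) ?_
        (by linarith)) hM0
      have h1 := hsep _ y.1.1.2 y.1.2 (by
        have h3 : ‖y.1.1.1.1‖ ≤ ε := y.2
        linarith)
      have h2 : r * ‖u y‖ = ‖y.1.1.1.2‖ := by
        simp only [u]
        rw [norm_smul, norm_inv, Real.norm_of_nonneg hr0.le]
        field_simp
      linarith
    have hmeas : diffraction Γ W (Metric.closedBall 0 ε) =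
        ∑' y : T, ENNReal.ofReal (diffractionWeight Γ W y.1.1.1) := by
      rw [diffraction, Measure.sum_apply _ Metric.isClosed_closedBall.measurableSet,
        tsum_subtype T fun y => ENNReal.ofReal (diffractionWeight Γ W y.1.1)]
      refine tsum_congr fun y => ?_
      rw [Measure.smul_apply, Measure.dirac_apply' _ Metric.isClosed_closedBall.measurableSet,
        smul_eq_mul]
      by_cases hy : ‖y.1.1.1‖ ≤ ε
      · rw [Set.indicator_of_mem (by simpa using hy), Set.indicator_of_mem (by exact hy)]
        simp
      · rw [Set.indicator_of_notMem (by simpa using hy), Set.indicator_of_notMem (by exact hy)]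
        simp
    rw [hmeas]
    calc _ ≤ ∑' y : T, ENNReal.ofReal M * ENNReal.ofReal ((r / 2) ^ (-s)) *
          ENNReal.ofReal ((1 + ‖u y‖) ^ (-s)) := ENNReal.tsum_le_tsum hterm
      _ = ENNReal.ofReal M * ENNReal.ofReal ((r / 2) ^ (-s)) *
          ∑' y : T, ENNReal.ofReal ((1 + ‖u y‖) ^ (-s)) := ENNReal.tsum_mul_left
      _ ≤ ENNReal.ofReal M * ENNReal.ofReal ((r / 2) ^ (-s)) * K := by
        gcongr
        exact hKsum u hu
      _ = ENNReal.ofReal M * K * ENNReal.ofReal ((r / 2) ^ (-s)) := by ring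
      _ ≤ _ := by
        gcongr
        exact le_self_add
  have hfin : ENNReal.ofReal M * K + S ≠ ⊤ :=
    ENNReal.add_ne_top.2 ⟨ENNReal.mul_ne_top ENNReal.ofReal_ne_top hK, hS⟩
  -- The summand `1` only makes the constant positive.
  refine ⟨(ENNReal.ofReal M * K + S).toReal * (a / 2) ^ (-s) + 1, by positivity,
    fun ε hε hε1 => ?_⟩
  have h1 := ENNReal.toReal_mono (ENNReal.mul_ne_top hfin ENNReal.ofReal_ne_top) (hbound ε hε hε1)
  rw [ENNReal.toReal_mul, ENNReal.toReal_ofReal (by positivity)] at h1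
  have h2 : (a * ε ^ (-(1 / κ)) / 2) ^ (-s) = (a / 2) ^ (-s) * ε ^ (s / κ) := by
    rw [mul_div_right_comm, Real.mul_rpow (by positivity) (by positivity), ← Real.rpow_mul hε.le]
    congr 2
    field_simp
  rw [h2] at h1
  have h3 : 0 ≤ ε ^ (s / κ) := by positivity
  calc _ ≤ _ := h1
    _ ≤ _ := by
      rw [add_mul, one_mul, mul_assoc]
      exact le_add_of_nonneg_right h3

end Diffraction

end Hyperuniform

/-! ### The main theorem -/

open Hyperuniform MeasureTheory Filter Topology

theorem mainTheorem5 (d₁ d₂ : ℕ) (hd₁ : 0 < d₁) (hd₂ : 0 < d₂)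
    (W : Set (Hyperuniform.E d₂)) (hW : Hyperuniform.IsWindow W)
    (ϑ : ℝ) (hϑ : 0 < ϑ) (hWϑ : Hyperuniform.FourierSmooth W ϑ)
    (δ : ℝ) (hδ : 0 < δ) :
    Hyperuniform.ForAlmostEveryLattice d₁ d₂ fun Γ _ _ =>
      Hyperuniform.ProjectsInjectively Γ ∧ Hyperuniform.ProjectsDensely Γ ∧
      ∃ σ : MeasureTheory.Measure (Hyperuniform.E d₁),
        Hyperuniform.IsCenteredDiffraction (Hyperuniform.torusMeasure Γ)
          (Hyperuniform.cutAndProject Γ W) σ ∧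
        (∀ τ : MeasureTheory.Measure (Hyperuniform.E d₁),
          Hyperuniform.IsCenteredDiffraction (Hyperuniform.torusMeasure Γ)
            (Hyperuniform.cutAndProject Γ W) τ → τ = σ) ∧
        Hyperuniform.IsSpectrallyHyperuniform σ ∧
        ∃ C : ℝ, 0 < C ∧ ∀ ε : ℝ, 0 < ε → ε ≤ 1 →
          σ.real (Metric.closedBall 0 ε) /
              (MeasureTheory.volume : MeasureTheory.Measure (Hyperuniform.E d₁)).real (Metric.closedBall 0 ε) ≤
            C * ε ^ (d₁ * (ϑ - δ) / (d₂ + δ)) := by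
  -- Taking `δ' < ϑ` keeps the exponent `e` positive, so hyperuniformity follows even when `δ ≥ ϑ`.
  -- As the exponent decreases in `δ`, the bound with `δ'` implies the one with `δ` for `ε ≤ 1`.
  let δ' := min δ (ϑ / 2)
  have hδ' : 0 < δ' := lt_min hδ (by linarith)
  have hδδ : δ' ≤ δ := min_le_left _ _
  have hδϑ : δ' < ϑ := (min_le_right _ _).trans_lt (by linarith)
  have hd₁' : (0 : ℝ) < d₁ := Nat.cast_pos.2 hd₁
  have hd₂' : (0 : ℝ) < d₂ := Nat.cast_pos.2 hd₂
  -- Just above the Diophantine threshold `d₂ / d₁`, and such that `(d₂ + ϑ) / κ` is `d₁`, the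
  -- exponent of the volume of the ball, plus `e`.
  let κ : ℝ := (d₂ + δ') / d₁
  have hκ : 0 < κ := by positivity
  have hκd : (d₂ : ℝ) < κ * d₁ := by
    simp only [κ]
    rw [div_mul_cancel₀ _ hd₁'.ne']
    linarith
  let e : ℝ := d₁ * (ϑ - δ') / (d₂ + δ')
  have he : 0 < e := div_pos (mul_pos hd₁' (by linarith)) (by linarith)
  have hexp : (d₂ + ϑ) / κ = d₁ + e := by
    simp only [κ, e]
    field_simp
    ring
  have hee : d₁ * (ϑ - δ) / (d₂ + δ) ≤ e := by
    simp only [e]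
    rw [div_le_div_iff₀ (by linarith) (by linarith), mul_assoc, mul_assoc]
    refine mul_le_mul_of_nonneg_left ?_ hd₁'.le
    nlinarith [mul_nonneg (sub_nonneg.2 hδδ) (by linarith : 0 ≤ d₂ + ϑ)]
  rw [ForAlmostEveryLattice]
  filter_upwards [ae_projectsInjectively_latticeOf hd₁, ae_dualSet_diophantine hd₁ hκd]
    with g hinj ⟨c, hc, hdual⟩
  have hdense : ProjectsDensely (latticeOf g) := by
    refine projectsDensely_of_dualSet fun y hy hy0 hy1 => ?_
    have h1 := hdual y hy hy0
    rw [hy1, norm_zero] at h1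
    have h2 : 0 < c * (1 + 0 + ‖y.2‖) ^ (-κ) := by positivity
    linarith
  have hσ := isCenteredDiffraction_diffraction hinj hW.1 hW.2.1
  obtain ⟨C, hC, hbound⟩ := diffraction_closedBall_le hinj hW.1 hW.2.1 hϑ hWϑ hκ hc hdual
  have hbound' : ∀ ε : ℝ, 0 < ε → ε ≤ 1 →
      (diffraction (latticeOf g) W).real (Metric.closedBall 0 ε) ≤ C * ε ^ e * ε ^ d₁ := by
    intro ε hε hε1
    refine (hbound ε hε hε1).trans (le_of_eq ?_)
    rw [hexp, Real.rpow_add hε, Real.rpow_natCast]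
    ring
  refine ⟨hinj, hdense, diffraction (latticeOf g) W, hσ,
    fun τ hτ => isCenteredDiffraction_unique hσ hτ, ?_, ?_⟩
  · have hlim : Tendsto (fun t : ℝ => C * t ^ e) (𝓝[>] 0) (𝓝 0) := by
      have h := ((Real.continuousAt_rpow_const 0 e (Or.inr he.le)).tendsto.const_mul C)
      rw [Real.zero_rpow he.ne', mul_zero] at h
      exact h.mono_left nhdsWithin_le_nhds
    refine tendsto_of_tendsto_of_tendsto_of_le_of_le' tendsto_const_nhds hlim ?_ ?_
    · filter_upwards [self_mem_nhdsWithin] with t ht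
      have ht : 0 < t := ht
      exact div_nonneg measureReal_nonneg (by positivity)
    · filter_upwards [Ioc_mem_nhdsGT (zero_lt_one (α := ℝ))] with t ht
      rw [div_le_iff₀ (pow_pos ht.1 _)]
      exact hbound' t ht.1 ht.2
  · let v : ℝ := (volume : Measure (E d₁)).real (Metric.ball 0 1)
    have hv : 0 < v := ENNReal.toReal_pos (Metric.measure_ball_pos volume 0 one_pos).ne'
      measure_ball_lt_top.ne
    refine ⟨C / v, by positivity, fun ε hε hε1 => ?_⟩
    rw [Measure.addHaar_real_closedBall volume _ hε.le, finrank_euclideanSpace_fin]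
    change _ / (ε ^ d₁ * v) ≤ _
    rw [div_le_iff₀ (by positivity)]
    calc _ ≤ C * ε ^ e * ε ^ d₁ := hbound' ε hε hε1
      _ ≤ C * ε ^ (d₁ * (ϑ - δ) / (d₂ + δ)) * ε ^ d₁ := by
        gcongr C * ?_ * _
        exact Real.rpow_le_rpow_of_exponent_ge hε hε1 hee
      _ = _ := by
        field_simp
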